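/- Let $\mathbb T$ be the unit circle with normalized Lebesgue measure $\ell$, let $I\subset\mathbb T$ be measurable with $\ell(I)>0$, put $J=\mathbb T\setminus I$, and assume $\ell(J)>0$. For $1\le p\le\infty$, let $H^p$ be the space of functions in $L^p(\mathbb T)$ (complex-valued) whose Fourier coefficients of strictly negative index vanish. For $1<s<\infty$, let $K_s$ be the norm of the conjugation operator $h\mapsto\widetilde h$ on the real space $L^s_{\mathbb R}(\mathbb T)$, where $\widetilde h$ is the function whose $n$-th Fourier coefficient is $-i\,\mathrm{sgn}(n)$ times that of $h$ (with $\mathrm{sgn}(0)=0$), i.e. $h+i\widetilde h$ is the boundary function of the Riesz--Herglotz transform of $h$. All norms on $I$ are taken with respect to $\ell$. Assume that the boundary of $I$ in $\mathbb T$ satisfies $\ell(\partial I)=0$ and that $f\in L^p(I)$ for some finite $p>2$. Let $g_0$ be the solution of the problem: $g_0\in H^2$, $|g_0|\le1$ a.e. on $J$, and $$\|f-g_0\|_{L^2(I)}=\min\{\|f-g\|_{L^2(I)} : g\in H^2,\ |g|\le 1\ \text{a.e. on } J\}.$$ Then $g_0\in H^p$, $K_{p/2}<\infty$, and $$\|g_0\|_{L^p(I)}\le(1+K_{p/2})\,\|f\|_{L^p(I)}.$$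 -/

import Mathlib

open MeasureTheory

open scoped ENNReal

noncomputable section

/-- The unit circle in the angular variable: a function `g` on it is `θ ↦ g (exp (i θ))`. -/
abbrev UCircle : Type := AddCircle (2 * Real.pi)

instance factTwoPiPos : Fact (0 < 2 * Real.pi) := ⟨Real.two_pi_pos⟩

/-- The normalized Lebesgue measure of the unit circle. -/
abbrev ell : Measure UCircle := AddCircle.haarAddCircle

/-- `g` represents an element of the Hardy space `H^p`: it lies in `L^p` of the circle and its
Fourier coefficients of strictly negative index vanish. -/
def MemHardy (p : ℝ≥0∞) (g : UCircle → ℂ) : Prop :=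
  MemLp g p ell ∧ ∀ n : ℤ, n < 0 → fourierCoeff g n = 0

/-- The candidates of the bounded extremal problem: `H²` functions of modulus at most `1`
almost everywhere on the complement of `I`. -/
def IsCandidate (I : Set UCircle) (g : UCircle → ℂ) : Prop :=
  MemHardy 2 g ∧ ∀ᵐ θ ∂(ell.restrict Iᶜ), ‖g θ‖ ≤ 1

/-- `g₀` solves the bounded extremal problem for the data `f` on `I`: it is a candidate which
minimizes the distance to `f` in `L²(I)` among all candidates. -/
def IsBEPSolution (I : Set UCircle) (f g₀ : UCircle → ℂ) : Prop :=
  IsCandidate I g₀ ∧ ∀ g : UCircle → ℂ, IsCandidate I g →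
    eLpNorm (f - g₀) 2 (ell.restrict I) ≤ eLpNorm (f - g) 2 (ell.restrict I)

/-- The integrable real function `k` is conjugate to the real function `h`: its Fourier series is
obtained from that of `h` through the multiplier `-i sgn n`. Equivalently, `h + i k` has no Fourier
coefficient of negative index and `k` has mean zero, so that `h + i k` is the boundary function
of the Riesz-Herglotz transform of `h`. -/
def IsConjugate (h k : UCircle → ℝ) : Prop :=
  Integrable k ell ∧ ∀ n : ℤ, fourierCoeff (fun θ => (k θ : ℂ)) n =
    -Complex.I * (n.sign : ℂ) * fourierCoeff (fun θ => (h θ : ℂ)) n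

/-- The operator norm of the conjugation operator on real `L^s` of the circle, as an extended
number (it is `∞` if the operator is not defined everywhere on `L^s` or is not bounded). -/
def conjugationNorm (s : ℝ≥0∞) : ℝ≥0∞ :=
  sInf {C : ℝ≥0∞ | ∀ h : UCircle → ℝ, MemLp h s ell →
    ∃ k : UCircle → ℝ, IsConjugate h k ∧ eLpNorm k s ell ≤ C * eLpNorm h s ell}

end

/-! The boundary of `I` is null, so `I` may be replaced by its interior. Let `w` be a smooth real
function supported in `I`, and let `u` be the analytic function with real part `w`, so that `u` is
purely imaginary on `J`. There `|1 + t u|² = 1 + t²|u|²`, hence `g₀ (1 + t u)` is admissible after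
division by `1 + t² M²`, a second-order correction. Optimality for `u` and `-u` therefore gives `Re
∫_I u g₀ conj (f - g₀) = 0` (`IsBEPSolution.re_integral_eq_zero`).

Let `v` be `Im (conj f · g₀)` on `I` and `0` elsewhere, with conjugate `k`. Then `(k - i v) u` has
purely imaginary mean. Adding this to the previous relation leaves a real density whose integral
against every `w` vanishes, so `|g₀|² = Re (conj f · g₀) + k` a.e. on `I`
(`IsBEPSolution.sq_norm_eq`). Hölder's inequality with `1/s = 1/p + 1/q` and boundedness of
conjugation on `L^s` yield `‖g₀‖_{2s}² ≤ (1 + C) ‖f‖_p ‖g₀‖_q` on `I`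
(`IsBEPSolution.eLpNorm_sq_le`). For `q = p` and `s = p/2`, dividing by `‖g₀‖_p` gives the claim,
provided that norm is finite.

Finiteness (`IsBEPSolution.memLp_restrict`) comes from iterating the same inequality from `q = 2`:
the reciprocals `1/q` move halfway to `1/p` each time, and Fatou's lemma reaches the limit. This
needs one bound for conjugation valid on a compact interval of exponents (`exists_rieszBound_Icc`),
proved for polynomials by the mean value property of `P^s` and by a doubling argument, then extended
by density. -/

section

/-! ### Polynomials on the circle and the mean value property. -/

open Polynomial ComplexConjugate

/-- The restriction of a polynomial to the unit circle. -/
noncomputable def circlePoly (P : ℂ[X]) : C(UCircle, ℂ) :=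
  ⟨fun θ => P.eval (fourier 1 θ), by fun_prop⟩

/-- The real part of a polynomial on the unit circle. -/
noncomputable def rePoly (P : ℂ[X]) : C(UCircle, ℝ) :=
  ⟨fun θ => (circlePoly P θ).re, by fun_prop⟩

/-- The imaginary part of a polynomial on the unit circle. -/
noncomputable def imPoly (P : ℂ[X]) : C(UCircle, ℝ) :=
  ⟨fun θ => (circlePoly P θ).im, by fun_prop⟩

theorem circlePoly_apply (P : ℂ[X]) (θ : UCircle) : circlePoly P θ = P.eval (fourier 1 θ) := rfl

theorem rePoly_apply (P : ℂ[X]) (θ : UCircle) : rePoly P θ = (P.eval (fourier 1 θ)).re := rfl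

theorem imPoly_apply (P : ℂ[X]) (θ : UCircle) : imPoly P θ = (P.eval (fourier 1 θ)).im := rfl

theorem norm_fourier_apply (n : ℤ) (θ : UCircle) : ‖(fourier n θ : ℂ)‖ = 1 :=
  Circle.norm_coe _

theorem fourier_nat (n : ℕ) (θ : UCircle) : (fourier (n : ℤ) θ : ℂ) = (fourier 1 θ) ^ n := by
  induction n with
  | zero => simp
  | succ n ih => rw [pow_succ, ← ih, ← fourier_add]; norm_cast

theorem exists_fourier_one_eq {z : ℂ} (hz : ‖z‖ = 1) : ∃ θ : UCircle, (fourier 1 θ : ℂ) = z := by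
  refine ⟨(z.arg : ℝ), ?_⟩
  rw [fourier_coe_apply]
  have h := Complex.norm_mul_exp_arg_mul_I z
  rw [hz, Complex.ofReal_one, one_mul] at h
  rw [← h]
  congr 1
  push_cast
  have : (Real.pi : ℂ) ≠ 0 := by exact_mod_cast Real.pi_ne_zero
  rw [h]
  field_simp

theorem integral_ell_eq_circleAverage (F : ℂ → ℂ) :
    ∫ θ : UCircle, F (fourier 1 θ) ∂ell = Real.circleAverage F 0 1 := by
  have h := fourierCoeff_eq_intervalIntegral (T := 2 * Real.pi)
    (fun θ : UCircle => F (fourier 1 θ)) 0 0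
  simp only [fourierCoeff, neg_zero, fourier_zero, one_smul] at h
  rw [h, Real.circleAverage, zero_add, one_div]
  congr 1
  refine intervalIntegral.integral_congr fun x _ => ?_
  rw [fourier_coe_apply, circleMap]
  congr 1
  have : (Real.pi : ℂ) ≠ 0 := by exact_mod_cast Real.pi_ne_zero
  simp only [Complex.ofReal_one, one_mul, zero_add]
  congr 1
  push_cast
  field_simp

theorem integral_ell_of_diffContOnCl {F : ℂ → ℂ} (hF : DiffContOnCl ℂ F (Metric.ball 0 1)) :
    ∫ θ : UCircle, F (fourier 1 θ) ∂ell = F 0 := by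
  rw [integral_ell_eq_circleAverage]
  exact DiffContOnCl.circleAverage (by simpa using hF)

theorem integral_circlePoly (P : ℂ[X]) : ∫ θ, circlePoly P θ ∂ell = P.eval 0 :=
  integral_ell_of_diffContOnCl (F := fun z => P.eval z) P.differentiable.diffContOnCl

theorem integrable_ell_of_continuous {E : Type*} [NormedAddCommGroup E] (φ : C(UCircle, E)) :
    Integrable φ ell :=
  φ.continuous.integrable_of_hasCompactSupport (HasCompactSupport.of_compactSpace _)

theorem integral_rePoly (P : ℂ[X]) : ∫ θ, rePoly P θ ∂ell = (P.eval 0).re := by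
  rw [← integral_circlePoly]
  exact integral_re (𝕜 := ℂ) (integrable_ell_of_continuous (circlePoly P))

theorem integral_imPoly (P : ℂ[X]) : ∫ θ, imPoly P θ ∂ell = (P.eval 0).im := by
  rw [← integral_circlePoly]
  exact integral_im (𝕜 := ℂ) (integrable_ell_of_continuous (circlePoly P))

/-- Positivity of the real part propagates from the circle to the closed disk. -/
theorem re_eval_pos_of_circle {P : ℂ[X]} (hP : ∀ θ, 0 < rePoly P θ) {z : ℂ} (hz : ‖z‖ ≤ 1) :
    0 < (P.eval z).re := by
  obtain ⟨θ₀, hθ₀⟩ := (rePoly P).continuous.exists_forall_le_of_hasCompactSupport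
    (HasCompactSupport.of_compactSpace _)
  refine (hP θ₀).trans_le ?_
  -- The maximum principle for `exp (-P)`, of modulus `exp (-Re P)`, is the minimum principle for
  -- `Re P`.
  have key := Complex.norm_le_of_forall_mem_frontier_norm_le (U := Metric.ball (0 : ℂ) 1)
    (f := fun z => Complex.exp (-P.eval z)) (C := Real.exp (-rePoly P θ₀))
    Metric.isBounded_ball (by
      have : Differentiable ℂ (fun z => Complex.exp (-P.eval z)) :=
        (P.differentiable.neg).cexp
      exact this.diffContOnCl) (by
      intro w hw
      rw [frontier_ball _ one_ne_zero, mem_sphere_zero_iff_norm] at hw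
      obtain ⟨θ, rfl⟩ := exists_fourier_one_eq hw
      rw [Complex.norm_exp, Complex.neg_re]
      exact Real.exp_le_exp.2 (neg_le_neg (hθ₀ θ))) (z := z)
      (by rw [closure_ball _ one_ne_zero]; simpa using hz)
  rw [Complex.norm_exp, Complex.neg_re, Real.exp_le_exp] at key
  linarith

/-- The values of `P` on the closed disk stay in the right half-plane, away from the branch cut, so
`P ^ s` is analytic there. -/
theorem integral_cpow_circlePoly {P : ℂ[X]} (hP : ∀ θ, 0 < rePoly P θ) (s : ℂ) :
    ∫ θ, (circlePoly P θ) ^ s ∂ell = (P.eval 0) ^ s := by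
  refine integral_ell_of_diffContOnCl (F := fun z => (P.eval z) ^ s) ?_
  refine DifferentiableOn.diffContOnCl ?_
  rw [closure_ball _ one_ne_zero]
  intro z hz
  refine DifferentiableAt.differentiableWithinAt ?_
  refine P.differentiable.differentiableAt.cpow_const (Or.inl ?_)
  exact re_eval_pos_of_circle hP (by simpa using hz)

/-! ### The pointwise inequality behind the Riesz bound. -/

/-- The trigonometric inequality behind the theorem of M. Riesz. -/
theorem exists_sin_rpow_le {a : ℝ} (ha : 1 < a) (ha2 : a ≤ 2) :
    ∃ A B : ℝ, 1 ≤ A ∧ 0 ≤ B ∧ ∀ s ∈ Set.Icc a (5 / 2), ∀ t : ℝ, |t| < Real.pi / 2 →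
      1 ≤ A * Real.cos t ^ s - B * Real.cos (s * t) := by
  have hpi := Real.pi_pos
  -- The midpoint of `π / (2a)` and `π / 2`: already `cos (a t₀) < 0`, while `cos t₀ > 0`.
  set t₀ : ℝ := Real.pi / 2 * ((1 + a) / (2 * a)) with ht₀
  have hat₀ : a * t₀ = Real.pi / 2 + Real.pi / 4 * (a - 1) := by
    rw [ht₀]; field_simp; ring
  have hat₀1 : Real.pi / 2 < a * t₀ := by nlinarith
  have hat₀2 : a * t₀ ≤ Real.pi := by nlinarith
  have ht₀pos : 0 < t₀ := by positivity
  have ht₀lt : t₀ < Real.pi / 2 := by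
    have : (1 + a) / (2 * a) < 1 := by rw [div_lt_one (by positivity)]; linarith
    rw [ht₀]; nlinarith
  have hc : 0 < -Real.cos (a * t₀) := by
    have := Real.cos_neg_of_pi_div_two_lt_of_lt hat₀1 (by linarith)
    linarith
  have hc₀ : 0 < Real.cos t₀ := Real.cos_pos_of_mem_Ioo ⟨by linarith, ht₀lt⟩
  set B : ℝ := (-Real.cos (a * t₀))⁻¹ with hB
  have hBpos : 0 < B := inv_pos.2 hc
  refine ⟨(1 + B) / Real.cos t₀ ^ 3, B, ?_, hBpos.le, ?_⟩
  · rw [le_div_iff₀ (by positivity)]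
    have := pow_le_one₀ hc₀.le (Real.cos_le_one t₀) (n := 3)
    linarith
  · intro s hs t ht
    have hs0 : 0 < s := by linarith [hs.1]
    rw [← Real.cos_abs t, ← Real.cos_abs (s * t), abs_mul, abs_of_pos hs0]
    have hct : 0 < Real.cos |t| :=
      Real.cos_pos_of_mem_Ioo ⟨by linarith [abs_nonneg t], ht⟩
    rcases le_total t₀ |t| with h | h
    -- Here `s|t|` lies in `[a t₀, 5π/4]`, no farther from `π` than `a t₀` is: `π - a t₀ ≥ π/4`
    -- because `a ≤ 2`. This fixes the upper limit `5/2` for `s`.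
    · have h1 : Real.cos (s * |t|) ≤ Real.cos (a * t₀) := by
        have hlow : a * t₀ ≤ s * |t| := mul_le_mul hs.1 h ht₀pos.le hs0.le
        have hupp : s * |t| ≤ 5 * Real.pi / 4 := by nlinarith [hs.2, abs_nonneg t]
        have h4 : Real.cos (Real.pi - a * t₀) ≤ Real.cos |s * |t| - Real.pi| :=
          Real.cos_le_cos_of_nonneg_of_le_pi (abs_nonneg _) (by nlinarith)
            (abs_le.2 ⟨by linarith, by nlinarith⟩)
        rw [Real.cos_abs, Real.cos_sub_pi, Real.cos_pi_sub] at h4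
        linarith
      have h2 : 0 ≤ (1 + B) / Real.cos t₀ ^ 3 * Real.cos |t| ^ s := by positivity
      have h3 : B * Real.cos (a * t₀) = -1 := by
        rw [hB, inv_neg, neg_mul, inv_mul_cancel₀ (by linarith)]
      nlinarith
    · have h1 : Real.cos t₀ ≤ Real.cos |t| :=
        Real.cos_le_cos_of_nonneg_of_le_pi (abs_nonneg t) (by linarith) h
      have h2 : Real.cos t₀ ^ 3 ≤ Real.cos |t| ^ s := by
        calc Real.cos t₀ ^ 3 ≤ Real.cos |t| ^ 3 := by gcongr
          _ = Real.cos |t| ^ (3 : ℝ) := by norm_cast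
          _ ≤ Real.cos |t| ^ s :=
            Real.rpow_le_rpow_of_exponent_ge hct (Real.cos_le_one _) (by linarith [hs.2])
      have h3 : 1 + B ≤ (1 + B) / Real.cos t₀ ^ 3 * Real.cos |t| ^ s := by
        rw [div_mul_eq_mul_div, le_div_iff₀ (by positivity)]
        gcongr
      nlinarith [Real.cos_le_one (s * |t|)]

/-- Polar coordinates: the trigonometric inequality at `t = arg z`, multiplied by `‖z‖ ^ s`. -/
theorem exists_abs_im_rpow_le {a : ℝ} (ha : 1 < a) (ha2 : a ≤ 2) :
    ∃ A B : ℝ, 1 ≤ A ∧ 0 ≤ B ∧ ∀ s ∈ Set.Icc a (5 / 2), ∀ z : ℂ, 0 < z.re →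
      |z.im| ^ s ≤ A * z.re ^ s - B * (z ^ (s : ℂ)).re := by
  obtain ⟨A, B, hA, hB, h⟩ := exists_sin_rpow_le ha ha2
  refine ⟨A, B, hA, hB, fun s hs z hz => ?_⟩
  have hs0 : 0 < s := by linarith [hs.1]
  have hz0 : z ≠ 0 := by rintro rfl; simp at hz
  have harg : |z.arg| < Real.pi / 2 := by
    rw [Complex.abs_arg_lt_pi_div_two_iff]; exact Or.inl hz
  have h1 := h s hs z.arg harg
  have hre : z.re = ‖z‖ * Real.cos z.arg := (Complex.norm_mul_cos_arg z).symm
  have hcos : 0 < Real.cos z.arg := by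
    rw [Complex.cos_arg hz0]; positivity
  have hpow : (z ^ (s : ℂ)).re = ‖z‖ ^ s * Real.cos (s * z.arg) := by
    rw [Complex.cpow_ofReal_re, mul_comm z.arg]
  have him : |z.im| ^ s ≤ ‖z‖ ^ s :=
    Real.rpow_le_rpow (abs_nonneg _) (Complex.abs_im_le_norm z) hs0.le
  rw [hpow, hre, Real.mul_rpow (norm_nonneg _) hcos.le]
  have hp : 0 < ‖z‖ ^ s := Real.rpow_pos_of_pos (norm_pos_iff.2 hz0) s
  nlinarith

end

/-! ### The theorem of M. Riesz for polynomials, uniformly in the exponent. -/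

section

open Polynomial ComplexConjugate

theorem rePoly_sub (P Q : ℂ[X]) : (rePoly (P - Q) : UCircle → ℝ) = rePoly P - rePoly Q := by
  ext θ; simp [rePoly_apply]

theorem imPoly_sub (P Q : ℂ[X]) : (imPoly (P - Q) : UCircle → ℝ) = imPoly P - imPoly Q := by
  ext θ; simp [imPoly_apply]

theorem memLp_ell_of_continuous {E : Type*} [NormedAddCommGroup E] (φ : C(UCircle, E))
    (s : ℝ≥0∞) : MemLp φ s ell :=
  φ.continuous.memLp_of_hasCompactSupport (HasCompactSupport.of_compactSpace _)

theorem aestronglyMeasurable_ell_of_continuous {E : Type*} [NormedAddCommGroup E]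
    (φ : C(UCircle, E)) : AEStronglyMeasurable φ ell :=
  (memLp_ell_of_continuous φ 1).1

theorem eLpNorm_norm_sq_eq {α E : Type*} [MeasurableSpace α] [NormedAddCommGroup E]
    {μ : Measure α} (φ : α → E) (s : ℝ≥0∞) :
    eLpNorm (fun θ => ‖φ θ‖ ^ 2) s μ = eLpNorm φ (2 * s) μ ^ 2 := by
  have h := eLpNorm_norm_rpow (p := s) (μ := μ) φ (q := 2) two_pos
  have h2 : ENNReal.ofReal 2 = 2 := by simp
  rw [h2, mul_comm s 2, ENNReal.rpow_ofNat] at h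
  rw [← h]
  refine eLpNorm_congr_norm_ae (Filter.Eventually.of_forall fun θ => ?_)
  simp

theorem eLpNorm_sq_eq (φ : UCircle → ℝ) (s : ℝ≥0∞) :
    eLpNorm (fun θ => φ θ ^ 2) s ell = eLpNorm φ (2 * s) ell ^ 2 := by
  rw [← eLpNorm_norm_sq_eq]
  simp only [Real.norm_eq_abs, sq_abs]

theorem holderTriple_two_mul (s : ℝ≥0∞) : ENNReal.HolderTriple (2 * s) (2 * s) s := by
  refine ⟨?_⟩
  rw [ENNReal.mul_inv (by simp) (by simp), ← two_mul, ← mul_assoc,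
    ENNReal.mul_inv_cancel (by simp) (by simp), one_mul]

theorem eLpNorm_mul_le_of_holderTriple {α 𝕜 : Type*} [MeasurableSpace α] [NormedRing 𝕜]
    {μ : Measure α} {q r s : ℝ≥0∞} (hqr : ENNReal.HolderTriple q r s) {φ ψ : α → 𝕜}
    (hφ : AEStronglyMeasurable φ μ) (hψ : AEStronglyMeasurable ψ μ) :
    eLpNorm (fun x => φ x * ψ x) s μ ≤ eLpNorm φ q μ * eLpNorm ψ r μ := by
  have h := eLpNorm_smul_le_mul_eLpNorm (𝕜 := 𝕜) (E := 𝕜) (μ := μ) hψ hφ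
    (p := q) (q := r) (r := s)
  exact h

/-- Each trigonometric polynomial is the sum of a polynomial and of the conjugate of another. -/
theorem exists_circlePoly_add_conj {τ : C(UCircle, ℂ)}
    (hτ : τ ∈ Submodule.span ℂ (Set.range (@fourier (2 * Real.pi)))) :
    ∃ P Q : ℂ[X], ∀ θ, τ θ = circlePoly P θ + conj (circlePoly Q θ) := by
  induction hτ using Submodule.span_induction with
  | mem x hx =>
    obtain ⟨n, rfl⟩ := hx
    obtain ⟨m, rfl | rfl⟩ := n.eq_nat_or_neg
    · refine ⟨X ^ m, 0, fun θ => ?_⟩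
      rw [circlePoly_apply, circlePoly_apply, fourier_nat]; simp
    · refine ⟨0, X ^ m, fun θ => ?_⟩
      rw [circlePoly_apply, circlePoly_apply, fourier_neg, fourier_nat]; simp
  | zero => exact ⟨0, 0, fun θ => by simp [circlePoly_apply]⟩
  | add x y _ _ hx hy =>
    obtain ⟨P, Q, h⟩ := hx
    obtain ⟨P', Q', h'⟩ := hy
    refine ⟨P + P', Q + Q', fun θ => ?_⟩
    simp only [circlePoly_apply, ContinuousMap.add_apply, h, h', eval_add, map_add]
    ring
  | smul a x _ hx =>
    obtain ⟨P, Q, h⟩ := hx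
    refine ⟨C a * P, C (conj a) * Q, fun θ => ?_⟩
    simp only [circlePoly_apply, ContinuousMap.smul_apply, h, eval_mul, eval_C, map_mul,
      smul_eq_mul, Complex.conj_conj]
    ring

/-- Real parts of polynomials that are real at the origin are dense in the continuous functions. -/
theorem exists_rePoly_near (φ : C(UCircle, ℝ)) {ε : ℝ} (hε : 0 < ε) :
    ∃ P : ℂ[X], (P.eval 0).im = 0 ∧ ∀ θ, |rePoly P θ - φ θ| < ε := by
  let Φ : C(UCircle, ℂ) := ⟨fun θ => (φ θ : ℂ), by fun_prop⟩
  have hΦ : Φ ∈ (Submodule.span ℂ (Set.range (@fourier (2 * Real.pi)))).topologicalClosure := by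
    rw [span_fourier_closure_eq_top]; trivial
  rw [← SetLike.mem_coe, Submodule.topologicalClosure_coe, Metric.mem_closure_iff] at hΦ
  obtain ⟨τ, hτ, hd⟩ := hΦ ε hε
  obtain ⟨P, Q, h⟩ := exists_circlePoly_add_conj hτ
  -- Conjugating `Q` or removing an imaginary constant does not change the real part.
  refine ⟨P + Q - C (((P + Q).eval 0).im * Complex.I), by simp, fun θ => ?_⟩
  have h1 : ‖Φ θ - τ θ‖ < ε := by
    rw [← dist_eq_norm]; exact (ContinuousMap.dist_apply_le_dist θ).trans_lt hd
  refine lt_of_le_of_lt ?_ h1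
  rw [norm_sub_rev, h θ]
  refine le_trans (le_of_eq ?_) (Complex.abs_re_le_norm _)
  simp [rePoly_apply, circlePoly_apply, Φ]

/-- The theorem of M. Riesz in `L^s` with constant `C`, for polynomials. -/
def RieszBound (s : ℝ≥0∞) (C : NNReal) : Prop :=
  ∀ P : ℂ[X], (P.eval 0).im = 0 → eLpNorm (imPoly P) s ell ≤ C * eLpNorm (rePoly P) s ell

/-- Since `A ≥ 1`, the constant `A ^ (1/s)` may be enlarged to `A`, which does not depend on `s`. -/
theorem eLpNorm_le_of_integral_rpow_le (φ ψ : C(UCircle, ℝ)) {s : ℝ} (hs : 1 ≤ s) {A : NNReal}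
    (hA : 1 ≤ A) (h : ∫ θ, |φ θ| ^ s ∂ell ≤ A * ∫ θ, |ψ θ| ^ s ∂ell) :
    eLpNorm φ (ENNReal.ofReal s) ell ≤ A * eLpNorm ψ (ENNReal.ofReal s) ell := by
  have hs0 : 0 < s := by linarith
  have hne : ENNReal.ofReal s ≠ 0 := by simpa using hs0
  rw [(memLp_ell_of_continuous φ _).eLpNorm_eq_integral_rpow_norm hne ENNReal.ofReal_ne_top,
    (memLp_ell_of_continuous ψ _).eLpNorm_eq_integral_rpow_norm hne ENNReal.ofReal_ne_top,
    ENNReal.toReal_ofReal hs0.le, ← ENNReal.ofReal_coe_nnreal (p := A),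
    ← ENNReal.ofReal_mul A.coe_nonneg]
  refine ENNReal.ofReal_le_ofReal ?_
  simp only [Real.norm_eq_abs]
  have hψ : 0 ≤ ∫ θ, |ψ θ| ^ s ∂ell := integral_nonneg fun θ => by positivity
  have hφ : 0 ≤ ∫ θ, |φ θ| ^ s ∂ell := integral_nonneg fun θ => by positivity
  have hA' : (1 : ℝ) ≤ A := by exact_mod_cast hA
  calc (∫ θ, |φ θ| ^ s ∂ell) ^ s⁻¹ ≤ (A * ∫ θ, |ψ θ| ^ s ∂ell) ^ s⁻¹ := by gcongr
    _ = (A : ℝ) ^ s⁻¹ * (∫ θ, |ψ θ| ^ s ∂ell) ^ s⁻¹ := Real.mul_rpow A.2 hψ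
    _ ≤ A * (∫ θ, |ψ θ| ^ s ∂ell) ^ s⁻¹ := by
      gcongr
      calc (A : ℝ) ^ s⁻¹ ≤ (A : ℝ) ^ (1 : ℝ) :=
            Real.rpow_le_rpow_of_exponent_le hA' (inv_le_one_of_one_le₀ hs)
        _ = A := Real.rpow_one _

/-- The mean of `Re P² = (Re P)² - (Im P)²` is `P(0)²`, nonnegative because `P(0)` is real. -/
theorem rieszBound_two : RieszBound 2 1 := by
  intro P hP
  have h2 : (2 : ℝ≥0∞) = ENNReal.ofReal 2 := by simp
  rw [h2]
  refine eLpNorm_le_of_integral_rpow_le _ _ one_le_two le_rfl ?_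
  have h := integral_rePoly (P ^ 2)
  have h1 : ∀ θ, rePoly (P ^ 2) θ = |rePoly P θ| ^ (2 : ℝ) - |imPoly P θ| ^ (2 : ℝ) := by
    intro θ
    simp only [rePoly_apply, imPoly_apply, Real.rpow_two, sq_abs, eval_pow]
    rw [sq, Complex.mul_re]; ring
  simp_rw [h1] at h
  rw [integral_sub] at h
  · have : 0 ≤ ((P ^ 2).eval 0).re := by
      rw [eval_pow, sq, Complex.mul_re, hP]; nlinarith
    simp only [NNReal.coe_one, one_mul]
    linarith
  · exact integrable_ell_of_continuous ⟨fun θ => |rePoly P θ| ^ (2 : ℝ), by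
      fun_prop (disch := norm_num)⟩
  · exact integrable_ell_of_continuous ⟨fun θ => |imPoly P θ| ^ (2 : ℝ), by
      fun_prop (disch := norm_num)⟩

/-- Integrate the pointwise inequality: the term with `Re P^s` has mean `P(0)^s > 0` and enters with
a nonpositive coefficient, so it can be dropped. -/
theorem exists_eLpNorm_imPoly_le_of_pos {a : ℝ} (ha : 1 < a) (ha2 : a ≤ 2) :
    ∃ A : NNReal, ∀ s ∈ Set.Icc a (5 / 2), ∀ P : ℂ[X], (P.eval 0).im = 0 → (∀ θ, 0 < rePoly P θ) →
      eLpNorm (imPoly P) (ENNReal.ofReal s) ell ≤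
        A * eLpNorm (rePoly P) (ENNReal.ofReal s) ell := by
  obtain ⟨A, B, hA, hB, h⟩ := exists_abs_im_rpow_le ha ha2
  refine ⟨⟨A, by linarith⟩, fun s hs P hP hpos => ?_⟩
  have hs0 : 0 ≤ s := by linarith [hs.1]
  refine eLpNorm_le_of_integral_rpow_le _ _ (by linarith [hs.1]) (by exact_mod_cast hA) ?_
  have hint1 : Integrable (fun θ => |imPoly P θ| ^ s) ell :=
    integrable_ell_of_continuous ⟨fun θ => |imPoly P θ| ^ s, by fun_prop (disch := assumption)⟩
  have hint2 : Integrable (fun θ => |rePoly P θ| ^ s) ell :=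
    integrable_ell_of_continuous ⟨fun θ => |rePoly P θ| ^ s, by fun_prop (disch := assumption)⟩
  have hint3' : Integrable (fun θ => (circlePoly P θ) ^ (s : ℂ)) ell :=
    integrable_ell_of_continuous ⟨fun θ => (circlePoly P θ) ^ (s : ℂ),
      (circlePoly P).continuous.cpow continuous_const fun θ => Or.inl (hpos θ)⟩
  have hint3 : Integrable (fun θ => ((circlePoly P θ) ^ (s : ℂ)).re) ell := hint3'.re
  have h0 : 0 < (P.eval 0).re := re_eval_pos_of_circle hpos (by simp)
  have hmean : 0 ≤ ∫ θ, ((circlePoly P θ) ^ (s : ℂ)).re ∂ell := by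
    have := integral_re (𝕜 := ℂ) hint3'
    simp only [RCLike.re_to_complex] at this
    rw [this, integral_cpow_circlePoly hpos]
    have : P.eval 0 = (((P.eval 0).re : ℝ) : ℂ) := by
      apply Complex.ext <;> simp [hP]
    rw [this, ← Complex.ofReal_cpow h0.le, Complex.ofReal_re]
    positivity
  calc ∫ θ, |imPoly P θ| ^ s ∂ell
      ≤ ∫ θ, (A * |rePoly P θ| ^ s - B * ((circlePoly P θ) ^ (s : ℂ)).re) ∂ell := by
        refine integral_mono hint1 ((hint2.const_mul A).sub (hint3.const_mul B)) fun θ => ?_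
        simp only
        rw [abs_of_pos (hpos θ)]
        exact h s hs (circlePoly P θ) (hpos θ)
    _ = A * ∫ θ, |rePoly P θ| ^ s ∂ell - B * ∫ θ, ((circlePoly P θ) ^ (s : ℂ)).re ∂ell := by
        rw [integral_sub (hint2.const_mul A) (hint3.const_mul B), integral_const_mul,
          integral_const_mul]
    _ ≤ A * ∫ θ, |rePoly P θ| ^ s ∂ell := by nlinarith

theorem exists_rePoly_pos_near (φ : C(UCircle, ℝ)) (hφ : ∀ θ, 0 ≤ φ θ) {ε : ℝ} (hε : 0 < ε) :
    ∃ P : ℂ[X], (P.eval 0).im = 0 ∧ (∀ θ, 0 < rePoly P θ) ∧ ∀ θ, |rePoly P θ - φ θ| ≤ ε := by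
  obtain ⟨P, hP, h⟩ := exists_rePoly_near (φ + ContinuousMap.const _ (ε / 2)) (half_pos hε)
  refine ⟨P, hP, fun θ => ?_, fun θ => ?_⟩ <;>
  · have := abs_lt.1 (h θ)
    simp only [ContinuousMap.add_apply, ContinuousMap.const_apply] at this
    first
    | linarith [hφ θ]
    | exact abs_le.2 ⟨by linarith, by linarith⟩

/-- Up to a constant, `(Im P)² - (Re P)²` is conjugate to `2 Re P Im P`. The bound in `L^s` and
Hölder's inequality give `X² ≤ Y² + 2K X Y` for the `L^{2s}` norms, which forces `X ≤ (2K + 1) Y`.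
-/
theorem rieszBound_two_mul {s : ℝ≥0∞} {K : NNReal} (hs : 1 ≤ s) (h : RieszBound s K) :
    RieszBound (2 * s) (2 * K + 1) := by
  intro P hP
  set X := eLpNorm (imPoly P) (2 * s) ell with hX
  set Y := eLpNorm (rePoly P) (2 * s) ell with hY
  have hXt : X ≠ ∞ := (memLp_ell_of_continuous (imPoly P) _).2.ne
  have hYt : Y ≠ ∞ := (memLp_ell_of_continuous (rePoly P) _).2.ne
  -- The constant makes `Q(0) = 0`. It adds `P(0)² ≥ 0` to `Im Q`, which only helps when `(Im P)²`
  -- is bounded above.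
  set Q : ℂ[X] := C (-Complex.I) * P ^ 2 + C (Complex.I * P.eval 0 ^ 2) with hQ
  have hQ0 : (Q.eval 0).im = 0 := by simp [hQ]
  have hre : ∀ θ, rePoly Q θ = 2 * (rePoly P θ * imPoly P θ) := by
    intro θ
    simp only [hQ, rePoly_apply, imPoly_apply, eval_add, eval_mul, eval_C, eval_pow]
    simp [sq, Complex.mul_re, Complex.mul_im, hP]; ring
  have him : ∀ θ, imPoly Q θ = imPoly P θ ^ 2 - rePoly P θ ^ 2 + (P.eval 0).re ^ 2 := by
    intro θ
    simp only [hQ, rePoly_apply, imPoly_apply, eval_add, eval_mul, eval_C, eval_pow]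
    simp [sq, Complex.mul_re, Complex.mul_im, hP]
  have hm := fun T : ℂ[X] => aestronglyMeasurable_ell_of_continuous (imPoly T)
  have hm' := fun T : ℂ[X] => aestronglyMeasurable_ell_of_continuous (rePoly T)
  have hsq : AEStronglyMeasurable (fun θ => rePoly P θ ^ 2) ell :=
    aestronglyMeasurable_ell_of_continuous ⟨_, (rePoly P).continuous.pow 2⟩
  have key : X ^ 2 ≤ Y ^ 2 + 2 * K * (Y * X) := by
    rw [hX, hY, ← eLpNorm_sq_eq, ← eLpNorm_sq_eq]
    calc eLpNorm (fun θ => imPoly P θ ^ 2) s ell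
        ≤ eLpNorm ((fun θ => rePoly P θ ^ 2) + fun θ => ‖imPoly Q θ‖) s ell := by
          refine eLpNorm_mono_real fun θ => ?_
          rw [Real.norm_eq_abs, abs_of_nonneg (sq_nonneg _), Pi.add_apply, Real.norm_eq_abs]
          have := le_abs_self (imPoly Q θ)
          rw [him] at this ⊢
          nlinarith [sq_nonneg (P.eval 0).re]
      _ ≤ eLpNorm (fun θ => rePoly P θ ^ 2) s ell + eLpNorm (fun θ => ‖imPoly Q θ‖) s ell :=
          eLpNorm_add_le hsq (hm Q).norm hs
      _ ≤ eLpNorm (fun θ => rePoly P θ ^ 2) s ell +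
            2 * K * (eLpNorm (rePoly P) (2 * s) ell * eLpNorm (imPoly P) (2 * s) ell) := by
          gcongr
          rw [eLpNorm_norm]
          refine (h Q hQ0).trans ?_
          have : (rePoly Q : UCircle → ℝ) = (2 : ℝ) • fun θ => rePoly P θ * imPoly P θ := by
            ext θ; simp [hre]
          rw [this, eLpNorm_const_smul]
          have h2 : ‖(2 : ℝ)‖ₑ = 2 := by simp [enorm_eq_nnnorm]
          rw [h2, mul_comm 2 (K : ℝ≥0∞), mul_assoc]
          gcongr
          exact eLpNorm_mul_le_of_holderTriple (holderTriple_two_mul s) (hm' P) (hm P)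
  lift X to NNReal using hXt with x
  lift Y to NNReal using hYt with y
  norm_cast at key ⊢
  by_contra! hlt
  have hx : y ≤ x := by
    refine le_trans ?_ hlt.le
    calc y = 1 * y := (one_mul y).symm
      _ ≤ (2 * K + 1) * y := by gcongr; simp
  have hlt' : ((2 * K + 1) * y : ℝ) < x := by exact_mod_cast hlt
  have key' : (x : ℝ) ^ 2 ≤ y ^ 2 + 2 * K * (y * x) := by exact_mod_cast key
  have hx' : (y : ℝ) ≤ x := by exact_mod_cast hx
  have hx0 : (0 : ℝ) < x := lt_of_le_of_lt (by positivity) hlt'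
  nlinarith [mul_pos hx0 (sub_pos.2 hlt'), mul_nonneg y.2 (sub_nonneg.2 hx')]

/-- The positive and negative parts of `Re R` are approximated uniformly by positive real parts of
polynomials, to which the positive case applies. The remainder has uniformly small real part, and
the `L⁴` bound controls its imaginary part since `s ≤ 5/2 ≤ 4`. -/
theorem exists_rieszBound_Icc_two {a : ℝ} (ha : 1 < a) (ha2 : a ≤ 2) :
    ∃ C : NNReal, ∀ s ∈ Set.Icc a (5 / 2), RieszBound (ENNReal.ofReal s) C := by
  obtain ⟨A, hA⟩ := exists_eLpNorm_imPoly_le_of_pos ha ha2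
  refine ⟨2 * A, fun s hs R hR => ?_⟩
  set S := ENNReal.ofReal s with hS
  have hS1 : 1 ≤ S := by
    rw [hS, ENNReal.one_le_ofReal]; linarith [hs.1]
  have hS4 : S ≤ 2 * 2 := by
    have h4 : (2 * 2 : ℝ≥0∞) = ENNReal.ofReal 4 := by norm_num
    rw [hS, h4]
    exact ENNReal.ofReal_le_ofReal (by linarith [hs.2])
  set N := eLpNorm (rePoly R) S ell with hN
  have hconst : ∀ (ψ : C(UCircle, ℝ)) (ε : NNReal), (∀ θ, |ψ θ| ≤ ε) → ∀ r, eLpNorm ψ r ell ≤ ε := by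
    intro ψ ε hψ r
    refine (eLpNorm_le_of_ae_bound (C := ε) (Filter.Eventually.of_forall hψ)).trans ?_
    simp
  have step : ∀ ε : NNReal, 0 < ε →
      eLpNorm (imPoly R) S ell ≤ 2 * A * N + ε * (2 * A + 6) := by
    intro ε hε
    have hε' : (0 : ℝ) < ε := hε
    obtain ⟨P, hP0, hPpos, hP⟩ := exists_rePoly_pos_near
      ⟨fun θ => max (rePoly R θ) 0, (rePoly R).continuous.max continuous_const⟩ (fun θ => le_max_right _ _) hε'
    obtain ⟨Q, hQ0, hQpos, hQ⟩ := exists_rePoly_pos_near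
      ⟨fun θ => max (-rePoly R θ) 0, (rePoly R).continuous.neg.max continuous_const⟩ (fun θ => le_max_right _ _) hε'
    simp only [ContinuousMap.coe_mk] at hP hQ
    have bound : ∀ T : ℂ[X], (∀ θ, 0 < rePoly T θ) → (∀ θ, rePoly T θ ≤ |rePoly R θ| + ε) →
        eLpNorm (rePoly T) S ell ≤ N + ε := by
      intro T hT hle
      calc eLpNorm (rePoly T) S ell
          ≤ eLpNorm ((fun θ => |rePoly R θ|) + fun _ => (ε : ℝ)) S ell := by
            refine eLpNorm_mono_real fun θ => ?_
            rw [Real.norm_eq_abs, abs_of_pos (hT θ)]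
            exact hle θ
        _ ≤ eLpNorm (fun θ => |rePoly R θ|) S ell + eLpNorm (fun _ : UCircle => (ε : ℝ)) S ell :=
            eLpNorm_add_le (aestronglyMeasurable_ell_of_continuous ⟨_, (rePoly R).continuous.abs⟩)
              aestronglyMeasurable_const hS1
        _ ≤ N + ε := by
            gcongr
            · exact (eLpNorm_norm (rePoly R)).le
            · exact hconst (ContinuousMap.const _ (ε : ℝ)) ε (fun θ => by simp) S
    have hPN : eLpNorm (rePoly P) S ell ≤ N + ε := bound P hPpos fun θ => by
      have h1 := (abs_le.1 (hP θ)).2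
      have h2 : max (rePoly R θ) 0 ≤ |rePoly R θ| := max_le (le_abs_self _) (abs_nonneg _)
      linarith
    have hQN : eLpNorm (rePoly Q) S ell ≤ N + ε := bound Q hQpos fun θ => by
      have h1 := (abs_le.1 (hQ θ)).2
      have h2 : max (-rePoly R θ) 0 ≤ |rePoly R θ| := max_le (neg_le_abs _) (abs_nonneg _)
      linarith
    have hD : eLpNorm (imPoly (R - (P - Q))) S ell ≤ 6 * ε := by
      calc eLpNorm (imPoly (R - (P - Q))) S ell
          ≤ eLpNorm (imPoly (R - (P - Q))) (2 * 2) ell :=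
            eLpNorm_le_eLpNorm_of_exponent_le hS4 (aestronglyMeasurable_ell_of_continuous _)
        _ ≤ (2 * 1 + 1 : NNReal) * eLpNorm (rePoly (R - (P - Q))) (2 * 2) ell :=
            rieszBound_two_mul one_le_two rieszBound_two _ (by simp [hR, hP0, hQ0])
        _ ≤ (2 * 1 + 1 : NNReal) * (2 * ε : NNReal) := by
            gcongr
            refine hconst _ (2 * ε) (fun θ => ?_) _
            rw [rePoly_sub, rePoly_sub]
            have h1 := abs_le.1 (hP θ)
            have h2 := abs_le.1 (hQ θ)
            have h3 : max (rePoly R θ) 0 - max (-rePoly R θ) 0 = rePoly R θ :=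
              max_zero_sub_max_neg_zero_eq_self _
            simp only [Pi.sub_apply, NNReal.coe_mul, NNReal.coe_ofNat]
            exact abs_le.2 ⟨by linarith, by linarith⟩
        _ = 6 * ε := by norm_cast; ring
    have hdecomp : (imPoly R : UCircle → ℝ) = (imPoly P - imPoly Q) + imPoly (R - (P - Q)) := by
      rw [imPoly_sub, imPoly_sub]; abel
    have hm := fun T : ℂ[X] => aestronglyMeasurable_ell_of_continuous (imPoly T)
    calc eLpNorm (imPoly R) S ell
        ≤ eLpNorm (imPoly P - imPoly Q : UCircle → ℝ) S ell +
            eLpNorm (imPoly (R - (P - Q))) S ell := by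
          rw [hdecomp]
          exact eLpNorm_add_le ((hm P).sub (hm Q)) (hm _) hS1
      _ ≤ (eLpNorm (imPoly P) S ell + eLpNorm (imPoly Q) S ell) + 6 * ε := by
          gcongr
          exact eLpNorm_sub_le (hm P) (hm Q) hS1
      _ ≤ (A * (N + ε) + A * (N + ε)) + 6 * ε := by
          gcongr
          · exact (hA s hs P hP0 hPpos).trans (by gcongr)
          · exact (hA s hs Q hQ0 hQpos).trans (by gcongr)
      _ = 2 * A * N + ε * (2 * A + 6) := by ring
  rw [ENNReal.coe_mul, ENNReal.coe_ofNat]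
  refine ENNReal.le_of_forall_pos_le_add fun δ hδ _ => ?_
  refine (step (δ / (2 * A + 6)) (by positivity)).trans (le_of_eq ?_)
  congr 1
  have : (δ / (2 * A + 6) * (2 * A + 6) : NNReal) = δ := div_mul_cancel₀ _ (by positivity)
  exact_mod_cast congrArg ENNReal.ofNNReal this

/-- The bound of M. Riesz, uniformly for exponents in a compact subinterval of `(1, ∞)`. -/
theorem exists_rieszBound_Icc {a : ℝ} (ha : 1 < a) (b : ℝ) :
    ∃ C : NNReal, ∀ s ∈ Set.Icc a b, RieszBound (ENNReal.ofReal s) C := by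
  -- With `c ≤ 5/4`, halving an exponent `s ≥ 5/2` stays above `c`, so the doubled intervals leave
  -- no gap.
  set c : ℝ := min a (5 / 4) with hc
  have hc1 : 1 < c := lt_min ha (by norm_num)
  have hca : c ≤ a := min_le_left _ _
  have hc4 : c ≤ 5 / 4 := min_le_right _ _
  have mono : ∀ {s : ℝ≥0∞} {C C' : NNReal}, C ≤ C' → RieszBound s C → RieszBound s C' :=
    fun hC h P hP => (h P hP).trans (by gcongr)
  have main : ∀ n : ℕ, ∃ C : NNReal, ∀ s ∈ Set.Icc c (5 / 2 * 2 ^ n),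
      RieszBound (ENNReal.ofReal s) C := by
    intro n
    induction n with
    | zero => simpa using exists_rieszBound_Icc_two hc1 (by linarith)
    | succ n ih =>
      obtain ⟨K, h⟩ := ih
      refine ⟨2 * K + 1, fun s hs => ?_⟩
      have h1 : (1 : ℝ) ≤ 2 ^ n := one_le_pow₀ one_le_two
      have h2 : (2 : ℝ) ^ (n + 1) = 2 * 2 ^ n := by ring
      rcases le_total s (5 / 2 * 2 ^ n) with hle | hle
      · exact mono (le_add_right (le_mul_of_one_le_left K.2 one_le_two)) (h s ⟨hs.1, hle⟩)
      · have h3 : s / 2 ∈ Set.Icc c (5 / 2 * 2 ^ n) :=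
          ⟨by linarith, by have := hs.2; rw [h2] at this; linarith⟩
        have h4 : ENNReal.ofReal s = 2 * ENNReal.ofReal (s / 2) := by
          rw [← ENNReal.ofReal_ofNat, ← ENNReal.ofReal_mul (by norm_num)]
          congr 1; ring
        rw [h4]
        refine rieszBound_two_mul ?_ (h _ h3)
        rw [ENNReal.one_le_ofReal]
        linarith [h3.1]
  obtain ⟨n, hn⟩ := pow_unbounded_of_one_lt b (one_lt_two (α := ℝ))
  obtain ⟨K, hK⟩ := main n
  refine ⟨K, fun s hs => hK s ⟨hca.trans hs.1, hs.2.trans ?_⟩⟩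
  have : (0 : ℝ) < 2 ^ n := by positivity
  linarith

end

/-! ### Conjugation on `L^s` by density. -/

section

open Polynomial ComplexConjugate Filter Topology

theorem fourierCoeff_ofReal_neg (h : UCircle → ℝ) (n : ℤ) :
    fourierCoeff (fun θ => (h θ : ℂ)) (-n) = conj (fourierCoeff (fun θ => (h θ : ℂ)) n) := by
  unfold fourierCoeff
  rw [← integral_conj]
  refine integral_congr_ae (Eventually.of_forall fun θ => ?_)
  simp only [smul_eq_mul, map_mul, Complex.conj_ofReal, ← fourier_neg]

theorem fourierCoeff_add_I_mul {h k : UCircle → ℝ} (hh : Integrable h ell)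
    (hk : Integrable k ell) (n : ℤ) :
    fourierCoeff (fun θ => (h θ : ℂ) + Complex.I * k θ) n =
      fourierCoeff (fun θ => (h θ : ℂ)) n + Complex.I * fourierCoeff (fun θ => (k θ : ℂ)) n := by
  rw [← fourierCoeff.const_mul]
  exact congrFun (fourierCoeff.add hh.ofReal (hk.ofReal.const_mul Complex.I)) n

/-- Vanishing of the negative coefficients of `h + i k` gives the multiplier for `n < 0`; as `h` and
`k` are real, conjugation gives it for `n > 0`. -/
theorem isConjugate_of_fourierCoeff {h k : UCircle → ℝ} (hh : Integrable h ell)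
    (hk : Integrable k ell) (hneg : ∀ n : ℤ, n < 0 →
      fourierCoeff (fun θ => (h θ : ℂ) + Complex.I * k θ) n = 0)
    (hzero : ∫ θ, k θ ∂ell = 0) : IsConjugate h k := by
  have key : ∀ n : ℤ, n < 0 → fourierCoeff (fun θ => (k θ : ℂ)) n =
      Complex.I * fourierCoeff (fun θ => (h θ : ℂ)) n := by
    intro n hn
    have h1 := hneg n hn
    rw [fourierCoeff_add_I_mul hh hk] at h1
    linear_combination (-Complex.I) * h1 + (fourierCoeff (fun θ => (k θ : ℂ)) n) * Complex.I_mul_I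
  refine ⟨hk, fun n => ?_⟩
  rcases lt_trichotomy n 0 with hn | rfl | hn
  · rw [key n hn, Int.sign_eq_neg_one_of_neg hn]; push_cast; ring
  · simp only [Int.sign_zero, Int.cast_zero, mul_zero, zero_mul]
    simp only [fourierCoeff, neg_zero, fourier_zero, one_smul]
    rw [integral_complex_ofReal, hzero, Complex.ofReal_zero]
  · have h1 := key (-n) (by omega)
    rw [fourierCoeff_ofReal_neg, fourierCoeff_ofReal_neg] at h1
    have h2 := congrArg conj h1
    rw [map_mul, Complex.conj_conj, Complex.conj_conj, Complex.conj_I] at h2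
    rw [h2, Int.sign_eq_one_of_pos hn]; push_cast; ring

theorem fourierCoeff_circlePoly_of_neg (P : ℂ[X]) {n : ℤ} (hn : n < 0) :
    fourierCoeff (circlePoly P) n = 0 := by
  obtain ⟨m, rfl⟩ : ∃ m : ℕ, n = -((m : ℤ) + 1) := ⟨(-n - 1).toNat, by omega⟩
  have h := integral_circlePoly (X ^ (m + 1) * P)
  rw [eval_mul, eval_pow, eval_X, zero_pow (Nat.succ_ne_zero m), zero_mul] at h
  rw [← h, fourierCoeff]
  refine integral_congr_ae (Eventually.of_forall fun θ => ?_)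
  simp only [neg_neg, smul_eq_mul, circlePoly_apply, eval_mul, eval_pow, eval_X]
  rw [← fourier_nat]; push_cast; rfl

theorem isConjugate_rePoly_imPoly {P : ℂ[X]} (hP : (P.eval 0).im = 0) :
    IsConjugate (rePoly P) (imPoly P) := by
  refine isConjugate_of_fourierCoeff (integrable_ell_of_continuous _)
    (integrable_ell_of_continuous _) (fun n hn => ?_) ((integral_imPoly P).trans hP)
  rw [← fourierCoeff_circlePoly_of_neg P hn]
  congr 1
  ext θ
  exact (congrArg _ (mul_comm _ _)).trans (Complex.re_add_im (circlePoly P θ))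

theorem tendsto_fourierCoeff {φ : UCircle → ℝ} {ψ : ℕ → UCircle → ℝ} (hφ : Integrable φ ell)
    (hψ : ∀ m, Integrable (ψ m) ell)
    (h : Tendsto (fun m => eLpNorm (ψ m - φ) 1 ell) atTop (𝓝 0)) (n : ℤ) :
    Tendsto (fun m => fourierCoeff (fun θ => (ψ m θ : ℂ)) n) atTop
      (𝓝 (fourierCoeff (fun θ => (φ θ : ℂ)) n)) := by
  unfold fourierCoeff
  have hint : ∀ χ : UCircle → ℝ, Integrable χ ell →
      Integrable (fun θ => (fourier (-n) θ : ℂ) • (χ θ : ℂ)) ell :=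
    fun χ hχ => (Integrable.fourier_smul (f := fun θ => (χ θ : ℂ)) hχ.ofReal (-n))
  refine tendsto_integral_of_L1' _ (hint φ hφ).1
    (Eventually.of_forall fun m => hint _ (hψ m)) ?_
  refine h.congr fun m => eLpNorm_congr_norm_ae (Eventually.of_forall fun θ => ?_)
  simp only [Pi.sub_apply]
  rw [← smul_sub, norm_smul, norm_fourier_apply, one_mul, ← Complex.ofReal_sub, Complex.norm_real]

theorem exists_rePoly_eLpNorm_sub_le {s : ℝ≥0∞} (hs : 1 ≤ s) (hs_top : s ≠ ∞)
    {h : UCircle → ℝ} (hh : MemLp h s ell) {ε : NNReal} (hε : 0 < ε) :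
    ∃ P : ℂ[X], (P.eval 0).im = 0 ∧ eLpNorm (rePoly P - h : UCircle → ℝ) s ell ≤ ε := by
  have hε2 : ((ε / 2 : NNReal) : ℝ≥0∞) ≠ 0 := by
    exact_mod_cast (half_pos hε).ne'
  obtain ⟨g, hg, hgm⟩ := hh.exists_boundedContinuous_eLpNorm_sub_le hs_top hε2
  obtain ⟨P, hP, hPg⟩ := exists_rePoly_near g.toContinuousMap (ε := ((ε / 2 : NNReal) : ℝ))
    (by exact_mod_cast half_pos hε)
  refine ⟨P, hP, ?_⟩
  have hsplit : (rePoly P - h : UCircle → ℝ) = (rePoly P - g : UCircle → ℝ) - (h - g) := by abel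
  have hPm := aestronglyMeasurable_ell_of_continuous (rePoly P)
  rw [hsplit]
  refine (eLpNorm_sub_le (hPm.sub hgm.1) (hh.1.sub hgm.1) hs).trans ?_
  have h1 : eLpNorm (rePoly P - g : UCircle → ℝ) s ell ≤ ((ε / 2 : NNReal) : ℝ≥0∞) := by
    refine (eLpNorm_le_of_ae_bound (C := ((ε / 2 : NNReal) : ℝ))
      (Eventually.of_forall fun θ => (hPg θ).le)).trans ?_
    simp [-NNReal.coe_div]
  calc _ ≤ ((ε / 2 : NNReal) : ℝ≥0∞) + ((ε / 2 : NNReal) : ℝ≥0∞) := add_le_add h1 hg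
    _ = ε := by rw [← ENNReal.coe_add, add_halves]

theorem eLpNorm_le_mul_of_tendsto {s : ℝ≥0∞} (hs : 1 ≤ s) {K : NNReal}
    {u v : ℕ → UCircle → ℝ} {k h : UCircle → ℝ} (hu : ∀ n, AEStronglyMeasurable (u n) ell)
    (hv : ∀ n, AEStronglyMeasurable (v n) ell) (hk : AEStronglyMeasurable k ell)
    (hh : AEStronglyMeasurable h ell)
    (huv : ∀ n, eLpNorm (u n) s ell ≤ K * eLpNorm (v n) s ell)
    (hku : Tendsto (fun n => eLpNorm (u n - k) s ell) atTop (𝓝 0))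
    (hhv : Tendsto (fun n => eLpNorm (v n - h) s ell) atTop (𝓝 0)) :
    eLpNorm k s ell ≤ K * eLpNorm h s ell := by
  have hbound : ∀ n, eLpNorm k s ell ≤ eLpNorm (u n - k) s ell +
      K * (eLpNorm (v n - h) s ell + eLpNorm h s ell) := by
    intro n
    calc eLpNorm k s ell = eLpNorm (u n - (u n - k)) s ell := by rw [sub_sub_cancel]
      _ ≤ eLpNorm (u n) s ell + eLpNorm (u n - k) s ell :=
          eLpNorm_sub_le (hu n) ((hu n).sub hk) hs
      _ ≤ K * (eLpNorm (v n - h) s ell + eLpNorm h s ell) + eLpNorm (u n - k) s ell := by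
          gcongr
          refine (huv n).trans ?_
          gcongr
          conv_lhs => rw [← sub_add_cancel (v n) h]
          exact eLpNorm_add_le ((hv n).sub hh) hh hs
      _ = _ := add_comm _ _
  refine ge_of_tendsto' (x := atTop) ?_ hbound
  have := hku.add (ENNReal.Tendsto.const_mul (hhv.add_const (eLpNorm h s ell))
    (Or.inr (ENNReal.coe_ne_top (r := K))))
  simpa using this

/-- The theorem of M. Riesz, extended from polynomials to `L^s` by density. -/
theorem RieszBound.exists_isConjugate {s : ℝ≥0∞} {K : NNReal} (hK : RieszBound s K) (hs : 1 ≤ s)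
    (hs_top : s ≠ ∞) {h : UCircle → ℝ} (hh : MemLp h s ell) :
    ∃ k : UCircle → ℝ, IsConjugate h k ∧ eLpNorm k s ell ≤ K * eLpNorm h s ell := by
  choose P hP0 hP using fun n : ℕ =>
    exists_rePoly_eLpNorm_sub_le hs hs_top hh (ε := (2⁻¹ : NNReal) ^ n) (by positivity)
  have hm' := fun n => aestronglyMeasurable_ell_of_continuous (rePoly (P n))
  have hm := fun n => aestronglyMeasurable_ell_of_continuous (imPoly (P n))
  have hlim : Tendsto (fun n => eLpNorm (rePoly (P n) - h : UCircle → ℝ) s ell) atTop (𝓝 0) := by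
    refine tendsto_of_tendsto_of_tendsto_of_le_of_le tendsto_const_nhds ?_ (fun _ => zero_le) hP
    rw [← ENNReal.coe_zero]
    exact ENNReal.tendsto_coe.2 (tendsto_pow_atTop_nhds_zero_of_lt_one zero_le
      (by rw [inv_lt_one₀] <;> norm_num))
  have hcauchy : ∀ N n m : ℕ, N ≤ n → N ≤ m →
      eLpNorm (imPoly (P n) - imPoly (P m) : UCircle → ℝ) s ell <
        ((2 * K + 1 : NNReal) : ℝ≥0∞) * (2⁻¹ : ℝ≥0∞) ^ N := by
    intro N n m hn hm
    have hpow : ∀ j, N ≤ j → eLpNorm (rePoly (P j) - h : UCircle → ℝ) s ell ≤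
        (((2⁻¹ : NNReal) ^ N : NNReal) : ℝ≥0∞) := fun j hj => (hP j).trans (by
      exact ENNReal.coe_le_coe.2 (pow_le_pow_of_le_one zero_le (by rw [inv_le_one₀] <;> norm_num) hj))
    have hsplit : (rePoly (P n - P m) : UCircle → ℝ) = (rePoly (P n) - h) - (rePoly (P m) - h) := by
      rw [rePoly_sub]; abel
    rw [← imPoly_sub]
    calc eLpNorm (imPoly (P n - P m)) s ell ≤ K * eLpNorm (rePoly (P n - P m)) s ell :=
          hK _ (by simp [hP0])
      _ ≤ K * ((((2⁻¹ : NNReal) ^ N : NNReal) : ℝ≥0∞) + (((2⁻¹ : NNReal) ^ N : NNReal) : ℝ≥0∞)) := by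
          gcongr
          rw [hsplit]
          exact (eLpNorm_sub_le ((hm' n).sub hh.1) ((hm' m).sub hh.1) hs).trans
            (add_le_add (hpow n hn) (hpow m hm))
      -- The extra `1` makes the estimate strict, even for `K = 0`, as the completeness lemma
      -- requires.
      _ < ((2 * K + 1 : NNReal) : ℝ≥0∞) * (2⁻¹ : ℝ≥0∞) ^ N := by
          have h2 : (2⁻¹ : ℝ≥0∞) = ((2⁻¹ : NNReal) : ℝ≥0∞) := by
            rw [ENNReal.coe_inv two_ne_zero]; rfl
          rw [h2]
          norm_cast
          have : (0 : NNReal) < 2⁻¹ ^ N := by positivity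
          calc K * (2⁻¹ ^ N + 2⁻¹ ^ N) = 2 * K * 2⁻¹ ^ N := by ring
            _ < (2 * K + 1) * 2⁻¹ ^ N := by gcongr; exact lt_add_one _
  have hsum : ∑' N : ℕ, ((2 * K + 1 : NNReal) : ℝ≥0∞) * (2⁻¹ : ℝ≥0∞) ^ N ≠ ∞ := by
    rw [ENNReal.tsum_mul_left, ENNReal.tsum_geometric]
    exact ENNReal.mul_ne_top ENNReal.coe_ne_top (by simp)
  obtain ⟨k, hk, hklim⟩ := Lp.cauchy_complete_eLpNorm hs
    (fun n => memLp_ell_of_continuous (imPoly (P n)) s) hsum hcauchy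
  have toOne : ∀ {ψ : ℕ → UCircle → ℝ}, (∀ n, AEStronglyMeasurable (ψ n) ell) →
      Tendsto (fun n => eLpNorm (ψ n) s ell) atTop (𝓝 0) →
      Tendsto (fun n => eLpNorm (ψ n) 1 ell) atTop (𝓝 0) := fun hψ ht =>
    tendsto_of_tendsto_of_tendsto_of_le_of_le tendsto_const_nhds ht (fun _ => zero_le)
      fun n => eLpNorm_le_eLpNorm_of_exponent_le hs (hψ n)
  refine ⟨k, ⟨hk.integrable hs, fun n => ?_⟩, ?_⟩
  · have h1 := tendsto_fourierCoeff (hh.integrable hs)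
      (fun m => integrable_ell_of_continuous (rePoly (P m)))
      (toOne (fun m => (hm' m).sub hh.1) hlim) n
    have h2 := tendsto_fourierCoeff (hk.integrable hs)
      (fun m => integrable_ell_of_continuous (imPoly (P m)))
      (toOne (fun m => (hm m).sub hk.1) hklim) n
    refine tendsto_nhds_unique h2 ((h1.const_mul _).congr fun m => ?_)
    exact ((isConjugate_rePoly_imPoly (hP0 m)).2 n).symm
  · exact eLpNorm_le_mul_of_tendsto hs hm hm' hk.1 hh.1 (fun n => hK _ (hP0 n)) hklim hlim

theorem RieszBound.conjugationNorm_le {s : ℝ≥0∞} {K : NNReal} (hK : RieszBound s K) (hs : 1 ≤ s)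
    (hs_top : s ≠ ∞) : conjugationNorm s ≤ K :=
  sInf_le fun _ hh => hK.exists_isConjugate hs hs_top hh

end

/-! ### Absolutely convergent Fourier series and the variation of the solution. -/

section

open ComplexConjugate Filter Topology

/-- The sum of an absolutely convergent Fourier series. -/
noncomputable def fourierSeries (a : ℤ → ℂ) (θ : UCircle) : ℂ := ∑' n, a n * fourier n θ

theorem norm_mul_fourier (a : ℤ → ℂ) (n : ℤ) (θ : UCircle) : ‖a n * fourier n θ‖ = ‖a n‖ := by
  rw [norm_mul, norm_fourier_apply, mul_one]

theorem hasSum_fourierSeries {a : ℤ → ℂ} (ha : Summable fun n => ‖a n‖) (θ : UCircle) :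
    HasSum (fun n => a n * fourier n θ) (fourierSeries a θ) :=
  (Summable.of_norm (by simpa only [norm_mul_fourier] using ha)).hasSum

theorem continuous_fourierSeries {a : ℤ → ℂ} (ha : Summable fun n => ‖a n‖) :
    Continuous (fourierSeries a) :=
  continuous_tsum (fun n => continuous_const.mul (fourier n).continuous) ha
    fun n θ => (norm_mul_fourier a n θ).le

theorem norm_fourierSeries_le {a : ℤ → ℂ} (ha : Summable fun n => ‖a n‖) (θ : UCircle) :
    ‖fourierSeries a θ‖ ≤ ∑' n, ‖a n‖ := by
  refine (norm_tsum_le_tsum_norm ?_).trans ?_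
  · simpa only [norm_mul_fourier] using ha
  · simp only [norm_mul_fourier]; exact le_rfl

theorem integrable_fourier_mul {φ : UCircle → ℂ} (hφ : Integrable φ ell) (n : ℤ) :
    Integrable (fun θ => fourier n θ * φ θ) ell :=
  Integrable.fourier_smul hφ n

theorem hasSum_integral_mul_fourierSeries {a : ℤ → ℂ} (ha : Summable fun n => ‖a n‖)
    {φ : UCircle → ℂ} (hφ : Integrable φ ell) :
    HasSum (fun n => a n * fourierCoeff φ (-n)) (∫ θ, φ θ * fourierSeries a θ ∂ell) := by
  have h := hasSum_integral_of_summable_integral_norm (μ := ell)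
    (F := fun n θ => a n * (fourier n θ * φ θ))
    (fun n => (integrable_fourier_mul hφ n).const_mul _) (by
      simp only [norm_mul, norm_fourier_apply, one_mul, integral_const_mul]
      exact ha.mul_right _)
  have h1 : ∫ θ, φ θ * fourierSeries a θ ∂ell = ∫ θ, ∑' n, a n * (fourier n θ * φ θ) ∂ell := by
    refine integral_congr_ae (Eventually.of_forall fun θ => ?_)
    simp only [fourierSeries]
    rw [← tsum_mul_left]
    exact tsum_congr fun n => by ring
  rw [h1]
  refine h.congr_fun fun n => ?_
  simp only [integral_const_mul, fourierCoeff, neg_neg, smul_eq_mul]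

theorem MemHardy.fourierSeries_mul {a : ℤ → ℂ} (ha : Summable fun n => ‖a n‖)
    (hneg : ∀ n < 0, a n = 0) {g : UCircle → ℂ} (hg : MemHardy 2 g) :
    MemHardy 2 (fun θ => fourierSeries a θ * g θ) := by
  have hgi : Integrable g ell := hg.1.integrable one_le_two
  refine ⟨?_, fun m hm => ?_⟩
  · refine MemLp.of_le_mul (c := ∑' n, ‖a n‖) hg.1
      ((continuous_fourierSeries ha).aestronglyMeasurable.mul hg.1.1)
      (Eventually.of_forall fun θ => ?_)
    rw [norm_mul]
    exact mul_le_mul_of_nonneg_right (norm_fourierSeries_le ha θ) (norm_nonneg _)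
  · have h := hasSum_integral_mul_fourierSeries ha (integrable_fourier_mul hgi (-m))
    have hz : ∀ n, a n * fourierCoeff (fun θ => (fourier (-m) θ : ℂ) * g θ) (-n) = 0 := by
      intro n
      rcases lt_or_ge n 0 with hn | hn
      · rw [hneg n hn, zero_mul]
      · have : fourierCoeff (fun θ => (fourier (-m) θ : ℂ) * g θ) (-n) =
            fourierCoeff g (m - n) := by
          unfold fourierCoeff
          refine integral_congr_ae (Eventually.of_forall fun θ => ?_)
          simp only [smul_eq_mul]
          rw [← mul_assoc, ← fourier_add]
          congr 3; ring
        rw [this, hg.2 _ (by omega), mul_zero]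
    simp only [hz] at h
    refine Eq.trans ?_ (hasSum_zero.unique h).symm
    refine integral_congr_ae (Eventually.of_forall fun θ => ?_)
    simp only [smul_eq_mul]; ring

theorem MemHardy.const_mul {g : UCircle → ℂ} (hg : MemHardy 2 g) (c : ℂ) :
    MemHardy 2 (fun θ => c * g θ) :=
  ⟨hg.1.const_mul c, fun n hn => by rw [fourierCoeff.const_mul, hg.2 n hn, mul_zero]⟩

theorem MemHardy.add {g h : UCircle → ℂ} (hg : MemHardy 2 g) (hh : MemHardy 2 h) :
    MemHardy 2 (fun θ => g θ + h θ) := by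
  refine ⟨hg.1.add hh.1, fun n hn => ?_⟩
  have := congrFun (fourierCoeff.add (hg.1.integrable one_le_two) (hh.1.integrable one_le_two)) n
  exact this.trans (by rw [Pi.add_apply, hg.2 n hn, hh.2 n hn, add_zero])

/-- First-order condition along a curve: expanding the square and dividing by the coefficient `t /
(1 + t² M²)` gives `2 Re ⟨D, X⟩ ≤ t L`, and `t` is small. The term in `G` comes from the
normalization of the competitor. -/
theorem re_inner_nonpos_of_forall_norm_le {E : Type*} [NormedAddCommGroup E]
    [InnerProductSpace ℂ E] {D X G : E} {M : ℝ}
    (h : ∀ t : ℝ, 0 < t → t ≤ 1 →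
      ‖D‖ ≤ ‖D - ((t / (1 + t ^ 2 * M ^ 2) : ℝ) : ℂ) • (X - ((t * M ^ 2 : ℝ) : ℂ) • G)‖) :
    (inner ℂ D X).re ≤ 0 := by
  by_contra! hpos
  set r := (inner ℂ D X).re with hr
  set L : ℝ := 2 * M ^ 2 * |(inner ℂ D G).re| + (‖X‖ + M ^ 2 * ‖G‖) ^ 2 with hL
  have hL0 : 0 ≤ L := by positivity
  have key : ∀ t : ℝ, 0 < t → t ≤ 1 → 2 * r ≤ t * L := by
    intro t ht ht1
    set c : ℝ := t / (1 + t ^ 2 * M ^ 2) with hc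
    have hc0 : 0 < c := by positivity
    have hct : c ≤ t := div_le_self ht.le (by nlinarith [sq_nonneg (t * M)])
    set Y : E := X - ((t * M ^ 2 : ℝ) : ℂ) • G with hY
    have h1 : ‖D‖ ^ 2 ≤ ‖D - (c : ℂ) • Y‖ ^ 2 := by gcongr; exact h t ht ht1
    rw [norm_sub_sq (𝕜 := ℂ), inner_smul_right, norm_smul, Complex.norm_real, Real.norm_eq_abs,
      abs_of_pos hc0, RCLike.re_to_complex, Complex.re_ofReal_mul] at h1
    have h2 : (inner ℂ D Y).re = r - t * M ^ 2 * (inner ℂ D G).re := by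
      rw [hY, inner_sub_right, inner_smul_right, Complex.sub_re, Complex.re_ofReal_mul]
    have h3 : ‖Y‖ ≤ ‖X‖ + M ^ 2 * ‖G‖ := by
      refine (norm_sub_le _ _).trans ?_
      rw [norm_smul, Complex.norm_real, Real.norm_eq_abs, abs_of_nonneg (by positivity)]
      gcongr
      nlinarith [sq_nonneg M]
    have h4 : 2 * (inner ℂ D Y).re ≤ c * ‖Y‖ ^ 2 := by
      have : c * (2 * (inner ℂ D Y).re) ≤ c * (c * ‖Y‖ ^ 2) := by nlinarith
      exact le_of_mul_le_mul_left this hc0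
    have h5 : c * ‖Y‖ ^ 2 ≤ t * (‖X‖ + M ^ 2 * ‖G‖) ^ 2 := by gcongr
    have h6 : t * M ^ 2 * (inner ℂ D G).re ≤ t * M ^ 2 * |(inner ℂ D G).re| := by
      gcongr; exact le_abs_self _
    rw [h2] at h4
    rw [hL]
    nlinarith
  have h1 := key (min 1 (r / (L + 1))) (by positivity) (min_le_left _ _)
  have h2 : min 1 (r / (L + 1)) * L ≤ r / (L + 1) * L := by gcongr; exact min_le_right _ _
  have h3 : r / (L + 1) * L ≤ r := by
    rw [div_mul_eq_mul_div, div_le_iff₀ (by positivity)]; nlinarith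
  linarith

/-- A purely imaginary perturbation of `1` changes the modulus only to second order. -/
theorem norm_one_add_real_mul_le {z : ℂ} {M t : ℝ} (hz : z.re = 0) (hM : ‖z‖ ≤ M) :
    ‖1 + (t : ℂ) * z‖ ≤ 1 + t ^ 2 * M ^ 2 := by
  have h1 : ‖z‖ ^ 2 ≤ M ^ 2 := by gcongr
  have h2 : ‖1 + (t : ℂ) * z‖ ^ 2 = 1 + t ^ 2 * ‖z‖ ^ 2 := by
    rw [← Complex.normSq_eq_norm_sq, ← Complex.normSq_eq_norm_sq, Complex.normSq_apply,
      Complex.normSq_apply]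
    simp [hz]; ring
  have h3 : t ^ 2 * ‖z‖ ^ 2 ≤ t ^ 2 * M ^ 2 := by gcongr
  refine (pow_le_pow_iff_left₀ (norm_nonneg _) (by positivity) two_ne_zero).1 ?_
  nlinarith [mul_nonneg (sq_nonneg t) (sq_nonneg M)]

/-- The variation of the solution in the direction `u g₀`, with `u` analytic and purely imaginary
on the complement of `I`. -/
theorem IsBEPSolution.re_integral_nonpos {I : Set UCircle} (hI : MeasurableSet I)
    {f g₀ : UCircle → ℂ} (hf : MemLp f 2 (ell.restrict I)) (hg₀ : IsBEPSolution I f g₀)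
    {a : ℤ → ℂ} (ha : Summable fun n => ‖a n‖) (hneg : ∀ n < 0, a n = 0)
    (hre : ∀ θ ∉ I, (fourierSeries a θ).re = 0) :
    (∫ θ in I, (fourierSeries a θ * g₀ θ) * conj (f θ - g₀ θ) ∂ell).re ≤ 0 := by
  set M : ℝ := ∑' n, ‖a n‖ with hM
  have hX : MemHardy 2 (fun θ => fourierSeries a θ * g₀ θ) := hg₀.1.1.fourierSeries_mul ha hneg
  have hXI := hX.1.restrict I
  have hGI := hg₀.1.1.1.restrict I
  have hD : MemLp (f - g₀) 2 (ell.restrict I) := hf.sub hGI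
  have key := re_inner_nonpos_of_forall_norm_le (D := hD.toLp) (X := hXI.toLp) (G := hGI.toLp)
    (M := M) fun t ht ht1 => by
      set c : ℝ := t / (1 + t ^ 2 * M ^ 2) with hc
      set b : ℝ := (1 + t ^ 2 * M ^ 2)⁻¹ with hb
      have hpos : 0 < 1 + t ^ 2 * M ^ 2 := by positivity
      -- With `u` the series and `b = 1 / (1 + t² M²)`, this competitor equals `g₀ + c (u g₀ - t M²
      -- g₀)`, where `c = t b`.
      have hcand : IsCandidate I
          (fun θ => (b : ℂ) * (g₀ θ + (t : ℂ) * (fourierSeries a θ * g₀ θ))) := by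
        refine ⟨(hg₀.1.1.add (hX.const_mul _)).const_mul _, ?_⟩
        filter_upwards [hg₀.1.2, ae_restrict_mem hI.compl] with θ hθ hθI
        have h1 : (b : ℂ) * (g₀ θ + (t : ℂ) * (fourierSeries a θ * g₀ θ)) =
            b * (1 + t * fourierSeries a θ) * g₀ θ := by ring
        rw [h1, norm_mul, norm_mul, Complex.norm_real, Real.norm_eq_abs, abs_of_pos (by positivity)]
        have h2 := norm_one_add_real_mul_le (t := t) (hre θ hθI) (norm_fourierSeries_le ha θ)
        have h3 : b * ‖1 + (t : ℂ) * fourierSeries a θ‖ ≤ 1 := by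
          rw [hb, inv_mul_le_one₀ hpos]; exact h2
        exact mul_le_one₀ h3 (norm_nonneg _) hθ
      have hmin := hg₀.2 _ hcand
      have hmem : MemLp (f - fun θ => (b : ℂ) * (g₀ θ + (t : ℂ) * (fourierSeries a θ * g₀ θ))) 2
          (ell.restrict I) := hf.sub (hcand.1.1.restrict I)
      have heq : hD.toLp - (c : ℂ) • (hXI.toLp - ((t * M ^ 2 : ℝ) : ℂ) • hGI.toLp) =
          hmem.toLp := by
        rw [← MemLp.toLp_const_smul, ← MemLp.toLp_sub, ← MemLp.toLp_const_smul, ← MemLp.toLp_sub]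
        refine MemLp.toLp_congr _ _ (Eventually.of_forall fun θ => ?_)
        have hbc : (c : ℂ) = t * b := by rw [hc, hb]; push_cast; ring
        have hb1 : (b : ℂ) * (1 + t ^ 2 * M ^ 2) = 1 := by
          rw [hb]; exact_mod_cast inv_mul_cancel₀ hpos.ne'
        simp only [Pi.sub_apply, Pi.smul_apply, smul_eq_mul, hbc]
        push_cast
        linear_combination (g₀ θ) * hb1
      rw [heq, Lp.norm_toLp, Lp.norm_toLp]
      exact ENNReal.toReal_mono hmem.2.ne hmin
  rw [L2.inner_def] at key
  refine le_of_eq_of_le (congrArg _ (integral_congr_ae ?_)) key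
  filter_upwards [hD.coeFn_toLp, hXI.coeFn_toLp] with θ h1 h2
  rw [h1, h2]
  simp

end

/-! ### Analytic functions with prescribed real part, and localization on `I`. -/

section

open ComplexConjugate Filter Topology

/-- The Fourier coefficients of the analytic function with real part `w`. -/
noncomputable def analyticCoeff (w : UCircle → ℝ) (n : ℤ) : ℂ :=
  (1 + (n.sign : ℂ)) * fourierCoeff (fun θ => (w θ : ℂ)) n

theorem analyticCoeff_of_neg (w : UCircle → ℝ) {n : ℤ} (hn : n < 0) : analyticCoeff w n = 0 := by
  simp [analyticCoeff, Int.sign_eq_neg_one_of_neg hn]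

theorem norm_one_add_sign_le (n : ℤ) : ‖(1 + (n.sign : ℂ))‖ ≤ 2 := by
  rcases lt_trichotomy n 0 with hn | rfl | hn
  · simp [Int.sign_eq_neg_one_of_neg hn]
  · simp
  · rw [Int.sign_eq_one_of_pos hn]; norm_num

theorem summable_norm_analyticCoeff {w : UCircle → ℝ}
    (hw : Summable fun n => ‖fourierCoeff (fun θ => (w θ : ℂ)) n‖) :
    Summable fun n => ‖analyticCoeff w n‖ := by
  refine Summable.of_nonneg_of_le (fun n => norm_nonneg _) (fun n => ?_) (hw.mul_left 2)
  rw [analyticCoeff, norm_mul]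
  exact mul_le_mul_of_nonneg_right (norm_one_add_sign_le n) (norm_nonneg _)

/-- Adding the conjugate series restores every coefficient of `w`, doubled, because `w` is real. -/
theorem re_fourierSeries_analyticCoeff (w : C(UCircle, ℝ))
    (hw : Summable fun n => ‖fourierCoeff (fun θ => (w θ : ℂ)) n‖) (θ : UCircle) :
    (fourierSeries (analyticCoeff w) θ).re = w θ := by
  have h1 := hasSum_fourierSeries (summable_norm_analyticCoeff hw) θ
  have h2 : HasSum (fun n => conj (analyticCoeff w (-n) * fourier (-n) θ))
      (conj (fourierSeries (analyticCoeff w) θ)) := by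
    have := (Complex.hasSum_conj'.2 h1)
    exact (Equiv.neg ℤ).hasSum_iff.2 this
  have h3 := has_pointwise_sum_fourier_series_of_summable
    (f := (⟨fun θ => (w θ : ℂ), by fun_prop⟩ : C(UCircle, ℂ))) (Summable.of_norm hw) θ
  have h4 : ∀ n : ℤ, analyticCoeff w n * fourier n θ +
      conj (analyticCoeff w (-n) * fourier (-n) θ) =
      2 * (fourierCoeff (fun θ => (w θ : ℂ)) n • fourier n θ) := by
    intro n
    rw [analyticCoeff, analyticCoeff, fourierCoeff_ofReal_neg, fourier_neg, Int.sign_neg]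
    simp only [map_mul, map_add, map_one, Complex.conj_conj, Int.cast_neg, map_neg, smul_eq_mul,
      map_intCast]
    ring
  have h5 := (h1.add h2).unique ((h3.mul_left 2).congr_fun fun n => h4 n)
  have h6 := congrArg Complex.re h5
  simp at h6
  linarith

theorem norm_fourierCoeff_liftIoc_le {ψ : ℝ → ℂ} {K : ℝ} (hK : ∀ x, ‖ψ x‖ ≤ K) (n : ℤ) :
    ‖fourierCoeff (AddCircle.liftIoc (2 * Real.pi) 0 ψ) n‖ ≤ K := by
  refine (norm_integral_le_of_norm_le_const (C := K) (Eventually.of_forall fun θ => ?_)).trans ?_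
  · rw [norm_smul, norm_fourier_apply, one_mul]
    exact hK _
  · simp

theorem fourierCoeff_liftIoc_of_hasDerivAt {ψ ψ' : ℝ → ℂ} (hψ : ∀ x, HasDerivAt ψ (ψ' x) x)
    (hψ' : Continuous ψ') (h0 : ψ 0 = 0) (h1 : ψ (2 * Real.pi) = 0) {n : ℤ} (hn : n ≠ 0) :
    ‖fourierCoeff (AddCircle.liftIoc (2 * Real.pi) 0 ψ) n‖ =
      ‖fourierCoeff (AddCircle.liftIoc (2 * Real.pi) 0 ψ') n‖ / |(n : ℝ)| := by
  rw [fourierCoeff_liftIoc_eq, fourierCoeff_liftIoc_eq,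
    fourierCoeffOn_of_hasDerivAt _ hn (fun x _ => hψ x) (hψ'.intervalIntegrable _ _)]
  have h1' : ψ (0 + 2 * Real.pi) = 0 := by rwa [zero_add]
  rw [h0, h1']
  have hpi : (Real.pi : ℝ) ≠ 0 := Real.pi_ne_zero
  simp only [norm_mul, norm_div, norm_neg, sub_self, mul_zero, zero_sub, norm_one,
    Complex.norm_I, mul_one, Complex.norm_ofNat, Complex.norm_real, Real.norm_eq_abs, zero_add,
    Complex.ofReal_mul, Complex.ofReal_ofNat, Complex.ofReal_zero, sub_zero,
    Complex.norm_intCast]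
  have hn' : |(n : ℝ)| ≠ 0 := by simpa using hn
  have hpi' : |Real.pi| ≠ 0 := by simp
  field_simp

/-- Two integrations by parts, without boundary terms, make the coefficients `O(n⁻²)`. -/
theorem summable_fourierCoeff_liftIoc {ψ : ℝ → ℝ} (hψ : ContDiff ℝ (⊤ : ℕ∞) ψ)
    (hs : HasCompactSupport ψ) (hsub : tsupport ψ ⊆ Set.Ioo 0 (2 * Real.pi)) :
    Summable fun n => ‖fourierCoeff
      (fun θ => ((AddCircle.liftIoc (2 * Real.pi) 0 ψ θ : ℝ) : ℂ)) n‖ := by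
  have hd : ∀ {χ : ℝ → ℝ}, ContDiff ℝ (⊤ : ℕ∞) χ → ContDiff ℝ (⊤ : ℕ∞) (deriv χ) := fun h =>
    (contDiff_infty_iff_deriv.1 h).2
  have hderiv : ∀ {χ : ℝ → ℝ}, ContDiff ℝ (⊤ : ℕ∞) χ →
      ∀ x, HasDerivAt (fun y => (χ y : ℂ)) ((deriv χ x : ℝ) : ℂ) x := fun h x =>
    ((contDiff_infty_iff_deriv.1 h).1 x).hasDerivAt.ofReal_comp
  have hvan : ∀ {χ : ℝ → ℝ}, tsupport χ ⊆ Set.Ioo 0 (2 * Real.pi) →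
      (χ 0 : ℂ) = 0 ∧ (χ (2 * Real.pi) : ℂ) = 0 := by
    intro χ h
    constructor <;> rw [Complex.ofReal_eq_zero] <;>
    exact image_eq_zero_of_notMem_tsupport fun hx => by simpa using h hx
  have hts : tsupport (deriv ψ) ⊆ Set.Ioo 0 (2 * Real.pi) := (tsupport_deriv_subset).trans hsub
  obtain ⟨K, hK⟩ := (hd (hd hψ)).continuous.bounded_above_of_compact_support hs.deriv.deriv
  have hbound : ∀ n : ℤ, n ≠ 0 → ‖fourierCoeff
      (fun θ => ((AddCircle.liftIoc (2 * Real.pi) 0 ψ θ : ℝ) : ℂ)) n‖ ≤ K * (1 / (n : ℝ) ^ 2) := by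
    intro n hn
    have h1 := fourierCoeff_liftIoc_of_hasDerivAt (hderiv hψ)
      (Complex.continuous_ofReal.comp (hd hψ).continuous) (hvan hsub).1 (hvan hsub).2 hn
    have h2 := fourierCoeff_liftIoc_of_hasDerivAt (hderiv (hd hψ))
      (Complex.continuous_ofReal.comp (hd (hd hψ)).continuous) (hvan hts).1 (hvan hts).2 hn
    have h3 : ‖fourierCoeff (AddCircle.liftIoc (2 * Real.pi) 0
        (fun x => ((deriv (deriv ψ) x : ℝ) : ℂ))) n‖ ≤ K :=
      norm_fourierCoeff_liftIoc_le (fun x => by simpa using hK x) n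
    have h4 : (fun θ => ((AddCircle.liftIoc (2 * Real.pi) 0 ψ θ : ℝ) : ℂ)) =
        AddCircle.liftIoc (2 * Real.pi) 0 (fun x => (ψ x : ℂ)) := rfl
    rw [h4, h1, h2, div_div, abs_mul_abs_self, ← sq, div_eq_mul_one_div]
    gcongr
  refine Summable.of_norm_bounded_eventually
    (g := fun n : ℤ => K * (1 / (n : ℝ) ^ 2)) ?_ ?_
  · exact ((Real.summable_one_div_int_pow (p := 2)).2 one_lt_two).mul_left K
  · have : {(0 : ℤ)}ᶜ ∈ cofinite := (Set.finite_singleton _).compl_mem_cofinite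
    filter_upwards [this] with n hn
    rw [norm_norm]
    exact hbound n hn

/-- The fundamental lemma of the calculus of variations in the chart `(0, 2π)`: bumps supported in
the preimage of `I` extend to admissible `w`. The single point of the circle that is missed is null.
-/
theorem ae_eq_zero_of_forall_integral_mul {I : Set UCircle} (hI : IsOpen I) {R : UCircle → ℝ}
    (hR : Integrable R ell)
    (h : ∀ w : C(UCircle, ℝ), Summable (fun n => ‖fourierCoeff (fun θ => (w θ : ℂ)) n‖) →
      (∀ θ ∉ I, w θ = 0) → ∫ θ, R θ * w θ ∂ell = 0) :
    ∀ᵐ θ ∂ell, θ ∈ I → R θ = 0 := by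
  have hpi := Real.two_pi_pos
  set U : Set ℝ := Set.Ioo 0 (2 * Real.pi) ∩ (fun x : ℝ => (x : UCircle)) ⁻¹' I with hU
  have hUo : IsOpen U := isOpen_Ioo.inter (hI.preimage (AddCircle.continuous_mk' _))
  have hRv : Integrable R volume := by
    rw [AddCircle.volume_eq_smul_haarAddCircle]
    exact hR.smul_measure ENNReal.ofReal_ne_top
  have hmp := AddCircle.measurePreserving_mk (2 * Real.pi) 0
  have hRI : IntegrableOn (fun x : ℝ => R x) (Set.Ioc 0 (0 + 2 * Real.pi)) :=
    hmp.integrable_comp_of_integrable hRv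
  have hloc : LocallyIntegrableOn (fun x : ℝ => R x) U volume := by
    refine (hRI.mono_set ?_).locallyIntegrableOn
    rw [zero_add]
    exact fun x hx => Set.Ioo_subset_Ioc_self hx.1
  have hzero := hUo.ae_eq_zero_of_integral_contDiff_smul_eq_zero hloc fun ψ hψ hs hsub => by
    have hsub' : tsupport ψ ⊆ Set.Ioo 0 (2 * Real.pi) := fun x hx => (hsub hx).1
    have hvan : ∀ x ∉ U, ψ x = 0 := fun x hx =>
      image_eq_zero_of_notMem_tsupport fun hx' => hx (hsub hx')
    have hcont : Continuous (AddCircle.liftIoc (2 * Real.pi) 0 ψ) := by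
      refine AddCircle.liftIoc_continuous ?_ hψ.continuous.continuousOn
      rw [hvan _ (by simp [hU]), hvan _ (by simp [hU])]
    have h1 := h ⟨_, hcont⟩ (summable_fourierCoeff_liftIoc hψ hs hsub') (by
      intro θ hθ
      obtain ⟨x, hx, rfl⟩ := (AddCircle.coe_image_Ioc_eq (2 * Real.pi) 0).ge (Set.mem_univ θ)
      simp only [ContinuousMap.coe_mk]
      rw [AddCircle.liftIoc_coe_apply hx]
      exact hvan x fun hx' => hθ hx'.2)
    rw [AddCircle.integral_haarAddCircle, smul_eq_zero] at h1
    have h2 := h1.resolve_left (inv_ne_zero hpi.ne')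
    rw [← AddCircle.integral_preimage (2 * Real.pi) 0] at h2
    rw [← h2, ← setIntegral_eq_integral_of_forall_compl_eq_zero
      (s := Set.Ioc 0 (0 + 2 * Real.pi))]
    · refine setIntegral_congr_fun measurableSet_Ioc fun x hx => ?_
      simp only [ContinuousMap.coe_mk]
      rw [AddCircle.liftIoc_coe_apply hx, smul_eq_mul, mul_comm]
    · intro x hx
      rw [hvan x fun hx' => hx (by rw [zero_add]; exact Set.Ioo_subset_Ioc_self hx'.1), zero_smul]
  have hne : ∀ᵐ x : ℝ, x ≠ 2 * Real.pi := by
    simp [ae_iff, measure_singleton]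
  have hall : ∀ᵐ x : ℝ ∂(volume.restrict (Set.Ioc 0 (0 + 2 * Real.pi))),
      (x : UCircle) ∈ I → R (x : UCircle) = 0 := by
    rw [ae_restrict_iff' measurableSet_Ioc]
    filter_upwards [hzero, hne] with x hx hx2 hxI hxm
    rw [zero_add] at hxI
    exact hx ⟨⟨hxI.1, lt_of_le_of_ne hxI.2 hx2⟩, hxm⟩
  have hinv := (measurePreserving_subtype_coe measurableSet_Ioc).comp
    (AddCircle.measurePreserving_equivIoc (2 * Real.pi) (a := 0))
  have hv : ∀ᵐ θ ∂(volume : Measure UCircle), θ ∈ I → R θ = 0 := by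
    filter_upwards [hinv.quasiMeasurePreserving.ae hall] with θ hθ
    have : (((AddCircle.equivIoc (2 * Real.pi) 0 θ : ℝ)) : UCircle) = θ :=
      (AddCircle.equivIoc (2 * Real.pi) 0).symm_apply_apply θ
    simp only [Function.comp_apply] at hθ
    rwa [this] at hθ
  rwa [AddCircle.volume_eq_smul_haarAddCircle, Measure.ae_ennreal_smul_measure_iff
    (ENNReal.ofReal_pos.2 hpi).ne'] at hv

end

/-! ### The identity for `|g₀|²` on `I` and the resulting norm inequality. -/

section

open ComplexConjugate Filter Topology

theorem fourierSeries_neg (a : ℤ → ℂ) (θ : UCircle) :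
    fourierSeries (fun n => -a n) θ = -fourierSeries a θ := by
  simp only [fourierSeries, neg_mul, tsum_neg]

theorem IsBEPSolution.re_integral_eq_zero {I : Set UCircle} (hI : MeasurableSet I)
    {f g₀ : UCircle → ℂ} (hf : MemLp f 2 (ell.restrict I)) (hg₀ : IsBEPSolution I f g₀)
    {a : ℤ → ℂ} (ha : Summable fun n => ‖a n‖) (hneg : ∀ n < 0, a n = 0)
    (hre : ∀ θ ∉ I, (fourierSeries a θ).re = 0) :
    (∫ θ in I, (fourierSeries a θ * g₀ θ) * conj (f θ - g₀ θ) ∂ell).re = 0 := by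
  refine le_antisymm (hg₀.re_integral_nonpos hI hf ha hneg hre) ?_
  have h := hg₀.re_integral_nonpos hI hf (a := fun n => -a n) (by simpa only [norm_neg] using ha)
    (fun n hn => by rw [hneg n hn, neg_zero])
    (fun θ hθ => by rw [fourierSeries_neg, Complex.neg_re, hre θ hθ, neg_zero])
  simp only [fourierSeries_neg, neg_mul, integral_neg, Complex.neg_re] at h
  linarith

theorem fourierCoeff_zero_im (v : UCircle → ℝ) :
    (fourierCoeff (fun θ => (v θ : ℂ)) 0).im = 0 := by
  simp only [fourierCoeff, neg_zero, fourier_zero, one_smul]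
  rw [integral_complex_ofReal, Complex.ofReal_im]

/-- The pairing of `k - i v` with the analytic function of real part `w` is purely imaginary. -/
theorem IsConjugate.re_integral_mul_fourierSeries {v k : UCircle → ℝ} (hk : IsConjugate v k)
    (hv : Integrable v ell) {w : UCircle → ℝ}
    (hw : Summable fun n => ‖fourierCoeff (fun θ => (w θ : ℂ)) n‖) :
    (∫ θ, ((k θ : ℂ) - Complex.I * v θ) * fourierSeries (analyticCoeff w) θ ∂ell).re = 0 := by
  have hint : Integrable (fun θ => (v θ : ℂ) + Complex.I * k θ) ell :=
    hv.ofReal.add (hk.1.ofReal.const_mul Complex.I)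
  have h := hasSum_integral_mul_fourierSeries (summable_norm_analyticCoeff hw) hint
  -- Both factors are analytic, so the mean of their product is the product of their means; these
  -- are real, and the factor `-i` makes the result imaginary.
  have hzero : ∀ n : ℤ, n ≠ 0 → analyticCoeff w n *
      fourierCoeff (fun θ => (v θ : ℂ) + Complex.I * k θ) (-n) = 0 := by
    intro n hn
    rcases lt_or_gt_of_ne hn with hn | hn
    · rw [analyticCoeff_of_neg w hn, zero_mul]
    · rw [fourierCoeff_add_I_mul hv hk.1, hk.2, Int.sign_eq_neg_one_of_neg (by omega : -n < 0)]
      push_cast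
      linear_combination (analyticCoeff w n * fourierCoeff (fun θ => (v θ : ℂ)) (-n)) *
        Complex.I_mul_I
  have h0 := h.unique (hasSum_single 0 hzero)
  rw [neg_zero, fourierCoeff_add_I_mul hv hk.1, hk.2] at h0
  simp only [Int.sign_zero, Int.cast_zero, mul_zero, zero_mul, add_zero, analyticCoeff,
    one_mul] at h0
  have h1 : ∫ θ, ((k θ : ℂ) - Complex.I * v θ) * fourierSeries (analyticCoeff w) θ ∂ell =
      -Complex.I * ∫ θ, ((v θ : ℂ) + Complex.I * k θ) * fourierSeries (analyticCoeff w) θ ∂ell := by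
    rw [← integral_const_mul]
    refine integral_congr_ae (Eventually.of_forall fun θ => ?_)
    simp only
    linear_combination ((k θ : ℂ) * fourierSeries (analyticCoeff w) θ) * Complex.I_mul_I
  rw [h1, h0]
  simp [Complex.mul_re, Complex.mul_im, fourierCoeff_zero_im]

/-- The pointwise identity satisfied by the solution on `I`. -/
theorem IsBEPSolution.sq_norm_eq {I : Set UCircle} (hI : IsOpen I) {f g₀ : UCircle → ℂ}
    (hf : MemLp f 2 (ell.restrict I)) (hg₀ : IsBEPSolution I f g₀) {k : UCircle → ℝ}
    (hk : IsConjugate (I.indicator fun θ => (conj (f θ) * g₀ θ).im) k) :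
    ∀ᵐ θ ∂(ell.restrict I), ‖g₀ θ‖ ^ 2 = (conj (f θ) * g₀ θ).re + k θ := by
  have hIm := hI.measurableSet
  have hG := hg₀.1.1.1.restrict I
  have hfg : Integrable (fun θ => conj (f θ) * g₀ θ) (ell.restrict I) :=
    MemLp.integrable_mul (p := 2) (q := 2) hf.star hG
  have hgg : Integrable (fun θ => ‖g₀ θ‖ ^ 2) (ell.restrict I) := hG.integrable_norm_pow two_ne_zero
  have hv : Integrable (I.indicator fun θ => (conj (f θ) * g₀ θ).im) ell :=
    (integrable_indicator_iff hIm).2 hfg.im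
  set v := I.indicator fun θ => (conj (f θ) * g₀ θ).im with hvdef
  set R : UCircle → ℝ := fun θ =>
    I.indicator (fun θ => ‖g₀ θ‖ ^ 2 - (conj (f θ) * g₀ θ).re) θ - k θ with hR
  have hRi : Integrable R ell := ((integrable_indicator_iff hIm).2 (hgg.sub hfg.re)).sub hk.1
  set Φ : UCircle → ℂ := I.indicator fun θ => -(g₀ θ * conj (f θ - g₀ θ)) with hΦ
  have hΦi : Integrable Φ ell := by
    refine (integrable_indicator_iff hIm).2 ?_
    exact (MemLp.integrable_mul (p := 2) (q := 2) hG (hf.sub hG).star).neg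
  -- Subtracting `k - i v` cancels the imaginary part of `Φ`. As `R` is real, `Re ∫ R u = ∫ R w`.
  have hRΦ : ∀ θ, (R θ : ℂ) = Φ θ - ((k θ : ℂ) - Complex.I * v θ) := by
    intro θ
    simp only [hR, hΦ, hvdef]
    by_cases hθ : θ ∈ I
    · simp only [Set.indicator_of_mem hθ]
      have h1 := Complex.re_add_im (conj (f θ) * g₀ θ)
      have h2 := Complex.mul_conj' (g₀ θ)
      push_cast
      rw [map_sub]
      linear_combination -h1 - h2
    · simp [Set.indicator_of_notMem hθ]
  have key := ae_eq_zero_of_forall_integral_mul hI hRi fun w hw hwI => by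
    have ha := summable_norm_analyticCoeff hw
    have hre := re_fourierSeries_analyticCoeff w hw
    have hu := (continuous_fourierSeries ha).aestronglyMeasurable (μ := ell)
    have h1 := hg₀.re_integral_eq_zero hIm hf ha (fun n hn => analyticCoeff_of_neg w hn)
      (fun θ hθ => by rw [hre, hwI θ hθ])
    have h2 := hk.re_integral_mul_fourierSeries hv hw
    have hmul : ∀ {φ : UCircle → ℂ}, Integrable φ ell →
        Integrable (fun θ => φ θ * fourierSeries (analyticCoeff w) θ) ell := fun hφ =>
      Integrable.mul_bdd (c := ∑' n, ‖analyticCoeff w n‖) hφ hu (Eventually.of_forall fun θ => norm_fourierSeries_le ha θ)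
    have hkv : Integrable (fun θ => (k θ : ℂ) - Complex.I * v θ) ell :=
      hk.1.ofReal.sub (hv.ofReal.const_mul Complex.I)
    have h3 : ∫ θ, Φ θ * fourierSeries (analyticCoeff w) θ ∂ell =
        -∫ θ in I, (fourierSeries (analyticCoeff w) θ * g₀ θ) * conj (f θ - g₀ θ) ∂ell := by
      rw [← integral_neg, ← integral_indicator hIm]
      refine integral_congr_ae (Eventually.of_forall fun θ => ?_)
      simp only [hΦ]
      by_cases hθ : θ ∈ I
      · simp only [Set.indicator_of_mem hθ]; ring
      · simp [Set.indicator_of_notMem hθ]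
    have h4 : ∫ θ, (R θ : ℂ) * fourierSeries (analyticCoeff w) θ ∂ell =
        (∫ θ, Φ θ * fourierSeries (analyticCoeff w) θ ∂ell) -
        ∫ θ, ((k θ : ℂ) - Complex.I * v θ) * fourierSeries (analyticCoeff w) θ ∂ell := by
      rw [← integral_sub (hmul hΦi) (hmul hkv)]
      refine integral_congr_ae (Eventually.of_forall fun θ => ?_)
      simp only [hRΦ, sub_mul]
    have h5 := congrArg Complex.re h4
    rw [Complex.sub_re, h2, h3, Complex.neg_re, h1, neg_zero, sub_zero] at h5
    rw [← h5]
    have h6 := integral_re (𝕜 := ℂ) (hmul hRi.ofReal)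
    simp only [RCLike.re_to_complex] at h6
    refine Eq.trans ?_ h6
    refine integral_congr_ae (Eventually.of_forall fun θ => ?_)
    simp only [Complex.coe_algebraMap, Complex.re_ofReal_mul, hre]
  rw [ae_restrict_iff' hIm]
  filter_upwards [key] with θ hθ hθI
  have h := hθ hθI
  simp only [hR, Set.indicator_of_mem hθI] at h
  linarith

/-- The exponent `q` is left free: it runs through the bootstrap, and `q = p` gives the final
estimate. -/
theorem IsBEPSolution.eLpNorm_sq_le {I : Set UCircle} (hI : IsOpen I) {f g₀ : UCircle → ℂ}
    (hg₀ : IsBEPSolution I f g₀) {p q s C : ℝ≥0∞} (hp : 2 ≤ p) (hs : 1 ≤ s)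
    (hpqs : ENNReal.HolderTriple p q s) (hf : MemLp f p (ell.restrict I))
    (hgq : MemLp g₀ q (ell.restrict I))
    (hC : ∀ h : UCircle → ℝ, MemLp h s ell →
      ∃ k : UCircle → ℝ, IsConjugate h k ∧ eLpNorm k s ell ≤ C * eLpNorm h s ell) :
    eLpNorm g₀ (2 * s) (ell.restrict I) ^ 2 ≤
      (1 + C) * (eLpNorm f p (ell.restrict I) * eLpNorm g₀ q (ell.restrict I)) := by
  have hIm := hI.measurableSet
  set N := eLpNorm (fun θ => conj (f θ) * g₀ θ) s (ell.restrict I) with hN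
  have hmeas : AEStronglyMeasurable (fun θ => conj (f θ) * g₀ θ) (ell.restrict I) :=
    hf.1.star.mul hgq.1
  have hNle : N ≤ eLpNorm f p (ell.restrict I) * eLpNorm g₀ q (ell.restrict I) := by
    refine (eLpNorm_mul_le_of_holderTriple hpqs hf.1.star hgq.1).trans_eq ?_
    congr 1
    exact eLpNorm_congr_norm_ae (Eventually.of_forall fun θ => by simp)
  have hNtop : N < ∞ := hNle.trans_lt (ENNReal.mul_lt_top hf.2 hgq.2)
  have hvN : eLpNorm (I.indicator fun θ => (conj (f θ) * g₀ θ).im) s ell ≤ N := by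
    rw [eLpNorm_indicator_eq_eLpNorm_restrict hIm]
    exact eLpNorm_mono fun θ => Complex.abs_im_le_norm _
  have himm : AEStronglyMeasurable (fun θ => (conj (f θ) * g₀ θ).im) (ell.restrict I) :=
    Complex.continuous_im.comp_aestronglyMeasurable hmeas
  have hvm : MemLp (I.indicator fun θ => (conj (f θ) * g₀ θ).im) s ell :=
    ⟨(aestronglyMeasurable_indicator_iff hIm).2 himm, hvN.trans_lt hNtop⟩
  obtain ⟨k, hk, hkC⟩ := hC _ hvm
  have hkm : AEStronglyMeasurable (fun θ => |k θ|) (ell.restrict I) := hk.1.1.norm.restrict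
  have hid := hg₀.sq_norm_eq hI (hf.mono_exponent hp) hk
  rw [← eLpNorm_norm_sq_eq]
  calc eLpNorm (fun θ => ‖g₀ θ‖ ^ 2) s (ell.restrict I)
      ≤ eLpNorm ((fun θ => ‖conj (f θ) * g₀ θ‖) + fun θ => |k θ|) s (ell.restrict I) := by
        refine eLpNorm_mono_ae_real ?_
        filter_upwards [hid] with θ hθ
        rw [Real.norm_eq_abs, abs_of_nonneg (sq_nonneg _), hθ, Pi.add_apply]
        exact add_le_add (Complex.re_le_norm _) (le_abs_self _)
    _ ≤ eLpNorm (fun θ => ‖conj (f θ) * g₀ θ‖) s (ell.restrict I) +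
          eLpNorm (fun θ => |k θ|) s (ell.restrict I) := eLpNorm_add_le hmeas.norm hkm hs
    _ ≤ N + C * N := by
        rw [eLpNorm_norm]
        gcongr
        calc eLpNorm (fun θ => |k θ|) s (ell.restrict I) ≤ eLpNorm (fun θ => |k θ|) s ell :=
              eLpNorm_mono_measure _ Measure.restrict_le_self
          _ = eLpNorm k s ell := eLpNorm_norm k
          _ ≤ C * N := hkC.trans (by gcongr)
    _ = (1 + C) * N := by ring
    _ ≤ _ := by gcongr

end

/-! ### Bootstrap of the integrability of `g₀`. -/

section

open ComplexConjugate Filter Topology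

theorem tendsto_const_enorm_rpow {Q : ℕ → ℝ} {P : ℝ} (hP : 0 < P) (hQ : ∀ n, 0 ≤ Q n)
    (h : Tendsto Q atTop (𝓝 P)) (c : NNReal) :
    Tendsto (fun n => (c : ℝ≥0∞) ^ Q n) atTop (𝓝 ((c : ℝ≥0∞) ^ P)) := by
  rw [← ENNReal.coe_rpow_of_nonneg _ hP.le]
  simp only [← ENNReal.coe_rpow_of_nonneg _ (hQ _)]
  exact ENNReal.tendsto_coe.2 ((NNReal.continuousAt_rpow (x := c) (y := P) (Or.inr hP)).tendsto.comp
    (tendsto_const_nhds.prodMk_nhds h))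

/-- Fatou's lemma, since `‖g x‖ ^ Q n` tends to `‖g x‖ ^ P` at every point. -/
theorem eLpNorm_le_of_tendsto_exponent {α E : Type*} [MeasurableSpace α] [NormedAddCommGroup E]
    {μ : Measure α} {g : α → E} (hg : AEStronglyMeasurable g μ) {Q : ℕ → ℝ} {P : ℝ} (hP : 0 < P)
    (hQ : ∀ n, 0 < Q n) (h : Tendsto Q atTop (𝓝 P)) {M : NNReal}
    (hM : ∀ n, eLpNorm g (ENNReal.ofReal (Q n)) μ ≤ M) :
    eLpNorm g (ENNReal.ofReal P) μ ≤ M := by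
  have hrw : ∀ {r : ℝ}, 0 < r → (eLpNorm g (ENNReal.ofReal r) μ ≤ M ↔
      ∫⁻ x, ‖g x‖ₑ ^ r ∂μ ≤ (M : ℝ≥0∞) ^ r) := by
    intro r hr
    rw [eLpNorm_eq_lintegral_rpow_enorm_toReal (by simpa using hr) ENNReal.ofReal_ne_top,
      ENNReal.toReal_ofReal hr.le, one_div, ENNReal.rpow_inv_le_iff hr]
  rw [hrw hP]
  have hlim : ∀ x, ‖g x‖ₑ ^ P = liminf (fun n => ‖g x‖ₑ ^ Q n) atTop := fun x =>
    (tendsto_const_enorm_rpow hP (fun n => (hQ n).le) h ‖g x‖₊).liminf_eq.symm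
  calc ∫⁻ x, ‖g x‖ₑ ^ P ∂μ = ∫⁻ x, liminf (fun n => ‖g x‖ₑ ^ Q n) atTop ∂μ := by simp only [hlim]
    _ ≤ liminf (fun n => ∫⁻ x, ‖g x‖ₑ ^ Q n ∂μ) atTop :=
        lintegral_liminf_le' fun n => hg.enorm.pow_const _
    _ ≤ liminf (fun n => (M : ℝ≥0∞) ^ Q n) atTop :=
        liminf_le_liminf (Eventually.of_forall fun n => (hrw (hQ n)).1 (hM n))
    _ = (M : ℝ≥0∞) ^ P := (tendsto_const_enorm_rpow hP (fun n => (hQ n).le) h M).liminf_eq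

/-- The solution is as integrable on `I` as the data. -/
theorem IsBEPSolution.memLp_restrict {I : Set UCircle} (hI : IsOpen I) {f g₀ : UCircle → ℂ}
    (hg₀ : IsBEPSolution I f g₀) {P : ℝ} (hP : 2 < P)
    (hf : MemLp f (ENNReal.ofReal P) (ell.restrict I)) :
    MemLp g₀ (ENNReal.ofReal P) (ell.restrict I) := by
  have hP0 : 0 < P := by linarith
  have hP' : 1 / P < 1 / 2 := one_div_lt_one_div_of_lt two_pos hP
  have hPpos : 0 < 1 / P := by positivity
  -- `x n` is the reciprocal of the exponent reached after `n` steps: it starts at `1/2` and halves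
  -- its distance to `1/P` each time.
  set x : ℕ → ℝ := fun n => 1 / P + (1 / 2) ^ n * (1 / 2 - 1 / P) with hx
  have hxlow : ∀ n, 1 / P ≤ x n := fun n =>
    le_add_of_nonneg_right (mul_nonneg (by positivity) (by linarith))
  have hxpos : ∀ n, 0 < x n := fun n => hPpos.trans_le (hxlow n)
  have hxle : ∀ n, x n ≤ 1 / 2 := fun n => by
    have : (1 / 2 : ℝ) ^ n ≤ 1 := pow_le_one₀ (by norm_num) (by norm_num)
    simp only [hx]; nlinarith
  have hxstep : ∀ n, 2 * x (n + 1) = 1 / P + x n := fun n => by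
    simp only [hx, pow_succ]; ring
  -- The Hölder exponent of the first step, the smallest that occurs; it exceeds `1` because `P >
  -- 2`.
  set a : ℝ := 1 / (1 / P + 1 / 2) with ha
  have ha1 : 1 < a := by rw [ha, one_lt_div (by positivity)]; linarith
  obtain ⟨K, hK⟩ := exists_rieszBound_Icc ha1 (P / 2)
  have hsmem : ∀ n, 1 / (2 * x (n + 1)) ∈ Set.Icc a (P / 2) := fun n => by
    constructor
    · rw [hxstep, ha]
      exact one_div_le_one_div_of_le (by linarith [hxpos n]) (by linarith [hxle n])
    · have : P / 2 = 1 / (2 * (1 / P)) := by field_simp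
      rw [this]
      exact one_div_le_one_div_of_le (by positivity) (by linarith [hxlow (n + 1)])
  set F := eLpNorm f (ENNReal.ofReal P) (ell.restrict I) with hF
  set q : ℕ → ℝ≥0∞ := fun n => ENNReal.ofReal (1 / x n) with hq
  have hq0 : q 0 = 2 := by simp [hq, hx]
  -- A bound preserved by the iteration: if the current norm is at most `M`, the square of the next
  -- is at most `(1 + K) F M ≤ M²`.
  set M : ℝ≥0∞ := max (eLpNorm g₀ 2 (ell.restrict I)) ((1 + K) * F) with hM
  have hG := hg₀.1.1.1.restrict I
  have hMtop : M ≠ ∞ := by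
    rw [hM, ne_eq, max_eq_top, not_or]
    exact ⟨hG.2.ne, ENNReal.mul_ne_top (by simp) hf.2.ne⟩
  have hbound : ∀ n, eLpNorm g₀ (q n) (ell.restrict I) ≤ M := by
    intro n
    induction n with
    | zero => rw [hq0]; exact le_max_left _ _
    | succ n ih =>
      set s := ENNReal.ofReal (1 / (2 * x (n + 1))) with hs
      have hs1 : 1 ≤ s := by
        rw [hs, ENNReal.one_le_ofReal]; exact ha1.le.trans (hsmem n).1
      have hstriple : ENNReal.HolderTriple (ENNReal.ofReal P) (q n) s := by
        refine ⟨?_⟩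
        rw [hs, hq, ← ENNReal.ofReal_inv_of_pos hP0,
          ← ENNReal.ofReal_inv_of_pos (one_div_pos.2 (hxpos n)),
          ← ENNReal.ofReal_inv_of_pos (one_div_pos.2 (mul_pos two_pos (hxpos (n + 1)))),
          ← ENNReal.ofReal_add (by positivity) (inv_nonneg.2 (one_div_pos.2 (hxpos n)).le)]
        congr 1
        simp only [one_div, inv_inv] at hxstep ⊢
        exact (hxstep n).symm
      have h2s : q (n + 1) = 2 * s := by
        have h2 : (2 : ℝ≥0∞) = ENNReal.ofReal 2 := by simp
        rw [hs, hq, h2, ← ENNReal.ofReal_mul two_pos.le]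
        have := (hxpos (n + 1)).ne'
        field_simp
      have hp2 : 2 ≤ ENNReal.ofReal P := by
        have h2 : (2 : ℝ≥0∞) = ENNReal.ofReal 2 := by simp
        rw [h2]; exact ENNReal.ofReal_le_ofReal hP.le
      have key := hg₀.eLpNorm_sq_le hI hp2 hs1 hstriple hf ⟨hG.1, ih.trans_lt hMtop.lt_top⟩
        fun h hh => (hK _ (hsmem n)).exists_isConjugate hs1 ENNReal.ofReal_ne_top hh
      rw [← h2s] at key
      have hMM : eLpNorm g₀ (q (n + 1)) (ell.restrict I) ^ 2 ≤ M ^ 2 := by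
        refine key.trans ?_
        rw [← mul_assoc, sq M]
        exact mul_le_mul' (le_max_right _ _) ih
      exact (ENNReal.pow_le_pow_left_iff two_ne_zero).1 hMM
  refine ⟨hG.1, ?_⟩
  have hlim : Tendsto (fun n => 1 / x n) atTop (𝓝 P) := by
    have h1 : Tendsto x atTop (𝓝 (1 / P)) := by
      have := ((tendsto_pow_atTop_nhds_zero_of_lt_one (r := (1 / 2 : ℝ)) (by norm_num)
        (by norm_num)).mul_const (1 / 2 - 1 / P)).const_add (1 / P)
      simpa [hx] using this
    simpa using h1.inv₀ hPpos.ne'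
  clear_value M
  lift M to NNReal using hMtop
  exact (eLpNorm_le_of_tendsto_exponent hG.1 hP0 (fun n => one_div_pos.2 (hxpos n)) hlim
    hbound).trans_lt ENNReal.coe_lt_top

theorem isBEPSolution_congr {I I' : Set UCircle} (h : I =ᵐ[ell] I') {f g₀ : UCircle → ℂ}
    (hg₀ : IsBEPSolution I f g₀) : IsBEPSolution I' f g₀ := by
  have h1 : ell.restrict I = ell.restrict I' := Measure.restrict_congr_set h
  have h2 : ell.restrict Iᶜ = ell.restrict I'ᶜ := Measure.restrict_congr_set h.compl
  have h3 : ∀ g, IsCandidate I g ↔ IsCandidate I' g := fun g => by rw [IsCandidate, IsCandidate, h2]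
  refine ⟨(h3 _).1 hg₀.1, fun g hg => ?_⟩
  rw [← h1]
  exact hg₀.2 g ((h3 g).2 hg)

/-- Off `I` the modulus is at most `1`, so only integrability on `I` is at stake. -/
theorem memHardy_of_memLp_restrict {I : Set UCircle} (hI : MeasurableSet I) {g : UCircle → ℂ}
    (hg : IsCandidate I g) {p : ℝ≥0∞} (hp : MemLp g p (ell.restrict I)) : MemHardy p g := by
  refine ⟨?_, hg.1.2⟩
  have h1 : MemLp g p (ell.restrict Iᶜ) := MemLp.of_bound hg.1.1.1.restrict 1 hg.2
  rw [← Set.indicator_self_add_compl I g]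
  exact ((memLp_indicator_iff_restrict hI).2 hp).add ((memLp_indicator_iff_restrict hI.compl).2 h1)

end

/-! ### The norm estimate with the sharp conjugation constant. -/

theorem mainTheorem7 (I : Set UCircle) (hI : 0 < ell I) (hJ : 0 < ell Iᶜ)
    (hbd : ell (frontier I) = 0) (p : ℝ≥0∞) (hp : 2 < p) (hp_top : p ≠ ∞)
    (f : UCircle → ℂ) (hf : MemLp f p (ell.restrict I))
    (g₀ : UCircle → ℂ) (hg₀ : IsBEPSolution I f g₀) :
    MemHardy p g₀ ∧
      conjugationNorm (p / 2) ≠ ∞ ∧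
      eLpNorm g₀ p (ell.restrict I) ≤
        (1 + conjugationNorm (p / 2)) * eLpNorm f p (ell.restrict I) := by
  have hae : I =ᵐ[ell] interior I := (interior_ae_eq_of_null_frontier hbd).symm
  have hres : ell.restrict I = ell.restrict (interior I) := Measure.restrict_congr_set hae
  have hg := isBEPSolution_congr hae hg₀
  rw [hres] at hf ⊢
  have hIo : IsOpen (interior I) := isOpen_interior
  generalize interior I = I' at hf hg hIo ⊢
  obtain ⟨P, hP0, rfl⟩ : ∃ P : ℝ, 0 ≤ P ∧ p = ENNReal.ofReal P :=
    ⟨p.toReal, ENNReal.toReal_nonneg, (ENNReal.ofReal_toReal hp_top).symm⟩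
  have h2 : (2 : ℝ≥0∞) = ENNReal.ofReal 2 := by simp
  have hP : 2 < P := by
    rw [h2] at hp; exact (ENNReal.ofReal_lt_ofReal_iff_of_nonneg two_pos.le).1 hp
  have hdiv : ENNReal.ofReal P / 2 = ENNReal.ofReal (P / 2) := by
    rw [h2, ENNReal.ofReal_div_of_pos two_pos]
  have hgP := hg.memLp_restrict hIo hP hf
  have hs1 : 1 ≤ ENNReal.ofReal P / 2 := by
    rw [hdiv, ENNReal.one_le_ofReal]; linarith
  have htwo : 2 * (ENNReal.ofReal P / 2) = ENNReal.ofReal P :=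
    ENNReal.mul_div_cancel (by simp) (by simp)
  have htriple := holderTriple_two_mul (ENNReal.ofReal P / 2)
  rw [htwo] at htriple
  refine ⟨memHardy_of_memLp_restrict hIo.measurableSet hg.1 hgP, ?_, ?_⟩
  · obtain ⟨K, hK⟩ := exists_rieszBound_Icc (a := P / 2) (by linarith) (P / 2)
    have hb := (hK _ ⟨le_rfl, le_rfl⟩).conjugationNorm_le (hdiv ▸ hs1) ENNReal.ofReal_ne_top
    rw [hdiv]
    exact (hb.trans_lt ENNReal.coe_lt_top).ne
  · set F := eLpNorm f (ENNReal.ofReal P) (ell.restrict I') with hF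
    set X := eLpNorm g₀ (ENNReal.ofReal P) (ell.restrict I') with hX
    have hle : ∀ C ∈ {C : ℝ≥0∞ | ∀ h : UCircle → ℝ, MemLp h (ENNReal.ofReal P / 2) ell →
        ∃ k : UCircle → ℝ, IsConjugate h k ∧ eLpNorm k (ENNReal.ofReal P / 2) ell ≤
          C * eLpNorm h (ENNReal.ofReal P / 2) ell}, X ≤ (1 + C) * F := by
      intro C hC
      have key := hg.eLpNorm_sq_le hIo hp.le hs1 htriple hf hgP hC
      rw [htwo, sq, ← mul_assoc] at key
      rcases eq_or_ne X 0 with h0 | h0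
      · rw [h0]; exact zero_le
      · exact (ENNReal.mul_le_mul_iff_left h0 hgP.2.ne).1 key
    -- The estimate holds for each admissible `C`; a sequence tending to the infimum carries it to
    -- `conjugationNorm`, so attainment is not needed.
    obtain ⟨C, -, hC, hCmem⟩ := exists_seq_tendsto_sInf (S := {C : ℝ≥0∞ | ∀ h : UCircle → ℝ,
      MemLp h (ENNReal.ofReal P / 2) ell → ∃ k : UCircle → ℝ, IsConjugate h k ∧
        eLpNorm k (ENNReal.ofReal P / 2) ell ≤ C * eLpNorm h (ENNReal.ofReal P / 2) ell})
      (by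
        obtain ⟨K, hK⟩ := exists_rieszBound_Icc (a := P / 2) (by linarith) (P / 2)
        refine ⟨K, fun h hh => ?_⟩
        rw [hdiv] at hh ⊢
        exact (hK _ ⟨le_rfl, le_rfl⟩).exists_isConjugate (hdiv ▸ hs1) ENNReal.ofReal_ne_top hh)
      (OrderBot.bddBelow _)
    exact ge_of_tendsto' (ENNReal.Tendsto.mul_const (hC.const_add 1) (Or.inr hf.2.ne))
      fun n => hle _ (hCmem n)
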